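/- Let $p$ be a prime number. Let $\mathrm{Sh}$ be the category of sheaves of sets on the category $\mathrm{Aff}$ of affine schemes for the étale topology. For a commutative ring $C$ let $W_n(C)=C^{n+1}$ be the ring of $p$-typical Witt vectors $(x_0,\dots,x_n)$ in Buium–Joyal components, i.e. with the ring laws that express $\delta^{\circ i}(x+y)$ and $\delta^{\circ i}(xy)$ ($0\le i\le n$) through the $\delta^{\circ j}(x),\delta^{\circ j}(y)$ in any $\delta$-ring. For $X\in\mathrm{Sh}$ let $J(X)$ be given by $J(X)(C)=\lim_n X(W_n(C))$; $J$ is a comonad, with counit $u\colon J(X)\to X$ induced by $W_0(C)=C$ and comultiplication induced by the ring homomorphisms $$\Delta\colon W_{m+n}(C)\to W_n(W_m(C)),\quad (x_0,\dots,x_{m+n})\mapsto\big((x_0,\dots,x_m),(x_1,\dots,x_{m+1}),\dots,(x_n,\dots,x_{m+n})\big).$$ A $\delta$-sheaf is a sheaf $X$ with a co-action $\alpha\colon X\to J(X)$ of this comonad (coassociative and counital), and a morphism of $\delta$-sheaves is a morphism of sheaves compatible with the co-actions. A lift of the Frobenius on a sheaf $X$ is an endomorphism $\varphi\colon X\to X$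 which restricts to the Frobenius on $X\times\operatorname{Spec}(\mathbf F_p)$, i.e. which agrees on $X(C)$, for every ring $C$ with $p=0$ in $C$, with the map induced by $C\to C$, $x\mapsto x^p$; morphisms of sheaves equipped with a lift of the Frobenius are the morphisms of sheaves commuting with the lifts. A $\delta$-sheaf $X$ has the lift of the Frobenius $$\varphi_X\colon X\xrightarrow{\ \alpha\ }J(X)\xrightarrow{\ \varphi_{J(X)}\ }J(X)\xrightarrow{\ u\ }X,$$ where $\varphi_{J(X)}$ is induced by the ring homomorphisms $W_{n+1}(C)\to W_n(C)$, $x\mapsto(x_0,\dots,x_n)^p+p\,(x_1,\dots,x_{n+1})$, for $x=(x_0,\dots,x_{n+1})$. A sheaf is called $p$-torsion free ind-affine if it is of the form $\operatorname{colim}_{i\in I}\operatorname{Spec}(R_i)$, with $I$ small and filtered, where the pro-abelian group $(R_i[p])_{i\in I}$ of $p$-torsion elements is isomorphic to the zero pro-abelian group. Then the forgetful functor $(X,\alpha)\mapsto(X,\varphi_X)$ from the category of $p$-torsion free ind-affine $\delta$-sheaves to the category of $p$-torsion free ind-affine sheaves equipped with a lift of the Frobenius is an equivalence of categories. -/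

import Mathlib

universe u

namespace DeltaSheaves

open CategoryTheory Limits Opposite

set_option linter.unusedSectionVars false

noncomputable section

section JetPolynomials

variable (p : ℕ) [hp : Fact p.Prime] {σ τ : Type}

/-- The ring `ℤ{x_s : s ∈ σ}` of polynomials in the symbols `δ^i(x_s)`, where the variable
`X (s, i)` stands for `δ^i(x_s)`. -/
abbrev JetPoly (σ : Type) : Type := MvPolynomial (σ × ℕ) ℤ

/-- The Frobenius lift of `ℤ{x_s}`, given by `δ^i(x_s) ↦ δ^i(x_s)^p + p δ^(i+1)(x_s)`. -/
def frob (σ : Type) : JetPoly σ →ₐ[ℤ] JetPoly σ :=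
  MvPolynomial.aeval fun v => MvPolynomial.X v ^ p + (p : JetPoly σ) * MvPolynomial.X (v.1, v.2 + 1)

theorem dvd_frob_sub_pow (f : JetPoly σ) : (p : JetPoly σ) ∣ frob p σ f - f ^ p := by
  induction f using MvPolynomial.induction_on with
  | C n =>
    have h : (p : ℤ) ∣ n - n ^ p := by
      rw [← ZMod.intCast_zmod_eq_zero_iff_dvd]
      simp
    obtain ⟨m, hm⟩ := h
    refine ⟨MvPolynomial.C m, ?_⟩
    have : frob p σ (MvPolynomial.C n) = MvPolynomial.C n := by simp [frob]
    rw [this, ← map_pow, ← map_sub, hm, map_mul]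
    simp
  | add f g hf hg =>
    obtain ⟨r, hr⟩ := exists_add_pow_prime_eq hp.out f g
    obtain ⟨a, ha⟩ := hf
    obtain ⟨b, hb⟩ := hg
    refine ⟨a + b - f * g * r, ?_⟩
    rw [map_add, hr]
    linear_combination ha + hb
  | mul_X f v hf =>
    obtain ⟨a, ha⟩ := hf
    refine ⟨a * MvPolynomial.X v ^ p + frob p σ f * MvPolynomial.X (v.1, v.2 + 1), ?_⟩
    have : frob p σ (MvPolynomial.X v) =
      MvPolynomial.X v ^ p + (p : JetPoly σ) * MvPolynomial.X (v.1, v.2 + 1) := by simp [frob]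
    rw [map_mul, this, mul_pow]
    linear_combination MvPolynomial.X v ^ p * ha

/-- The operator `δ(f) = (φ(f) - f^p) / p` on `ℤ{x_s}`. -/
def delta (f : JetPoly σ) : JetPoly σ := (dvd_frob_sub_pow p f).choose

theorem frob_eq (f : JetPoly σ) : frob p σ f = f ^ p + (p : JetPoly σ) * delta p f := by
  rw [delta, ← (dvd_frob_sub_pow p f).choose_spec]
  ring

theorem natCast_mul_cancel {f g : JetPoly σ} (h : (p : JetPoly σ) * f = (p : JetPoly σ) * g) :
    f = g :=
  mul_left_cancel₀ (Nat.cast_ne_zero.mpr hp.out.ne_zero) h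

theorem delta_X (v : σ × ℕ) :
    delta p (MvPolynomial.X v : JetPoly σ) = MvPolynomial.X (v.1, v.2 + 1) := by
  refine natCast_mul_cancel p ?_
  have := frob_eq p (MvPolynomial.X v : JetPoly σ)
  simp only [frob, MvPolynomial.aeval_X] at this
  linear_combination -this

/-- The first of three identities which characterize `δ`-rings, for `δ` on `ℤ{x_s}`. -/
theorem delta_one : delta p (1 : JetPoly σ) = 0 := by
  refine natCast_mul_cancel p ?_
  have := frob_eq p (1 : JetPoly σ)
  simp only [map_one, one_pow] at this
  linear_combination -this

theorem delta_mul (f g : JetPoly σ) :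
    delta p (f * g) = f ^ p * delta p g + delta p f * g ^ p + p * delta p f * delta p g := by
  refine natCast_mul_cancel p ?_
  have h := frob_eq p (f * g)
  rw [map_mul, frob_eq, frob_eq] at h
  linear_combination -h

theorem delta_add (f g : JetPoly σ) :
    delta p (f + g) = delta p f + delta p g -
      ∑ i ∈ Finset.Ico 1 p, ((p.choose i / p : ℕ) : JetPoly σ) * (f ^ i * g ^ (p - i)) := by
  refine natCast_mul_cancel p ?_
  have h := frob_eq p (f + g)
  have hs : (p : JetPoly σ) *
      ∑ i ∈ Finset.Ico 1 p, ((p.choose i / p : ℕ) : JetPoly σ) * (f ^ i * g ^ (p - i)) =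
      ∑ i ∈ Finset.Ico 1 p, f ^ i * g ^ (p - i) * (p.choose i : JetPoly σ) := by
    rw [Finset.mul_sum]
    refine Finset.sum_congr rfl fun i hi => ?_
    rw [Finset.mem_Ico] at hi
    have : p ∣ p.choose i := hp.out.dvd_choose_self (by omega) hi.2
    conv_rhs => rw [← Nat.mul_div_cancel' this]
    push_cast
    ring
  have hb : (f + g) ^ p = f ^ p + g ^ p +
      ∑ i ∈ Finset.Ico 1 p, f ^ i * g ^ (p - i) * (p.choose i : JetPoly σ) := by
    rw [add_pow, Finset.sum_range_succ, Finset.range_eq_Ico,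
      Finset.sum_eq_sum_Ico_succ_bot hp.out.pos]
    simp
    ring
  rw [map_add, frob_eq, frob_eq, hb] at h
  linear_combination -h + hs

theorem frob_mem_supported {k : ℕ} {f : JetPoly σ}
    (hf : f ∈ MvPolynomial.supported ℤ {v : σ × ℕ | v.2 ≤ k}) :
    frob p σ f ∈ MvPolynomial.supported ℤ {v : σ × ℕ | v.2 ≤ k + 1} := by
  have hX : ∀ v : σ × ℕ, v.2 ≤ k + 1 →
      (MvPolynomial.X v : JetPoly σ) ∈ MvPolynomial.supported ℤ {v : σ × ℕ | v.2 ≤ k + 1} :=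
    fun v hv => Algebra.subset_adjoin ⟨v, hv, rfl⟩
  have h : (MvPolynomial.supported ℤ {v : σ × ℕ | v.2 ≤ k}) ≤
      (MvPolynomial.supported ℤ {v : σ × ℕ | v.2 ≤ k + 1}).comap (frob p σ) := by
    refine Algebra.adjoin_le ?_
    rintro _ ⟨v, hv, rfl⟩
    have hv' : v.2 ≤ k := hv
    have : frob p σ (MvPolynomial.X v) =
      MvPolynomial.X v ^ p + (p : JetPoly σ) * MvPolynomial.X (v.1, v.2 + 1) := by simp [frob]
    simp only [SetLike.mem_coe, Subalgebra.mem_comap]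
    rw [this]
    exact add_mem (pow_mem (hX v (by omega)) p)
      (mul_mem (natCast_mem _ p) (hX (v.1, v.2 + 1) (by simp; omega)))
  exact h hf

theorem delta_mem_supported {k : ℕ} {f : JetPoly σ}
    (hf : f ∈ MvPolynomial.supported ℤ {v : σ × ℕ | v.2 ≤ k}) :
    delta p f ∈ MvPolynomial.supported ℤ {v : σ × ℕ | v.2 ≤ k + 1} := by
  have h1 : MvPolynomial.C (p : ℤ) * delta p f ∈
      MvPolynomial.supported ℤ {v : σ × ℕ | v.2 ≤ k + 1} := by
    have : MvPolynomial.C (p : ℤ) * delta p f = frob p σ f - f ^ p := by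
      rw [frob_eq]; simp
    rw [this]
    refine sub_mem (frob_mem_supported p hf) (pow_mem ?_ p)
    refine MvPolynomial.supported_mono ?_ hf
    intro v hv
    have hv' : v.2 ≤ k := hv
    exact Nat.le_succ_of_le hv'
  rw [MvPolynomial.mem_supported] at h1 ⊢
  rwa [MvPolynomial.vars_C_mul _ (Nat.cast_ne_zero.mpr hp.out.ne_zero)] at h1

theorem iterate_delta_mem_supported {f : JetPoly σ}
    (hf : f ∈ MvPolynomial.supported ℤ {v : σ × ℕ | v.2 ≤ 0}) (k : ℕ) :
    (delta p)^[k] f ∈ MvPolynomial.supported ℤ {v : σ × ℕ | v.2 ≤ k} := by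
  induction k with
  | zero => exact hf
  | succ k ih =>
    rw [Function.iterate_succ_apply']
    exact delta_mem_supported p ih

/-- The map of `δ`-rings `ℤ{x_s} → ℤ{y_t}` sending `x_s` to `q s`. -/
def substitute (q : σ → JetPoly τ) : JetPoly σ →ₐ[ℤ] JetPoly τ :=
  MvPolynomial.aeval fun v => (delta p)^[v.2] (q v.1)

theorem substitute_delta (q : σ → JetPoly τ) (f : JetPoly σ) :
    substitute p q (delta p f) = delta p (substitute p q f) := by
  have hcomm : (substitute p q).comp (frob p σ) = (frob p τ).comp (substitute p q) := by
    refine MvPolynomial.algHom_ext fun v => ?_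
    simp only [AlgHom.comp_apply]
    have h1 : frob p σ (MvPolynomial.X v) =
      MvPolynomial.X v ^ p + (p : JetPoly σ) * MvPolynomial.X (v.1, v.2 + 1) := by simp [frob]
    have h2 : ∀ w, substitute p q (MvPolynomial.X w) = (delta p)^[w.2] (q w.1) := by
      intro w; simp [substitute]
    rw [h1, map_add, map_mul, map_pow, h2, h2, map_natCast, frob_eq, Function.iterate_succ_apply']
  refine natCast_mul_cancel p ?_
  have h := DFunLike.congr_fun hcomm f
  simp only [AlgHom.comp_apply] at h
  rw [frob_eq, frob_eq, map_add, map_mul, map_pow, map_natCast] at h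
  exact add_left_cancel h

theorem substitute_iterate_delta (q : σ → JetPoly τ) (k : ℕ) (f : JetPoly σ) :
    substitute p q ((delta p)^[k] f) = (delta p)^[k] (substitute p q f) := by
  induction k generalizing f with
  | zero => rfl
  | succ k ih => rw [Function.iterate_succ_apply, ih, substitute_delta, Function.iterate_succ_apply]

end JetPolynomials

section WittVectors

/-- The underlying set `R^(n+1)` of the ring `W_n(R)` of truncated `p`-typical Witt vectors
`(x_0, …, x_n)`, in Buium–Joyal components. -/
@[ext]
structure Witt (p n : ℕ) (R : Type u) : Type u where
  /-- The components `x_0, …, x_n`. -/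
  coeff : Fin (n + 1) → R

namespace Witt

variable (p : ℕ) [hp : Fact p.Prime] (n : ℕ) {R : Type u} [CommRing R] {σ τ : Type}

/-- Evaluation of a polynomial in the `δ^i(x_s)` at a family of truncated Witt vectors:
`δ^i(x_s)` is sent to the `i`-th component of `a s`. -/
def eval {p n : ℕ} (a : σ → Witt p n R) : JetPoly σ →+* R :=
  MvPolynomial.eval₂Hom (Int.castRingHom R) fun v =>
    if h : v.2 < n + 1 then (a v.1).coeff ⟨v.2, h⟩ else 0

/-- The Witt vector `(f(q), f(δ(q)), …, f(δ^n(q)))`. -/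
def ofJet (f : JetPoly σ →+* R) (q : JetPoly σ) : Witt p n R :=
  ⟨fun k => f ((delta p)^[k] q)⟩

/-- The addition law: the `n`-th component of the sum is `S_n`, the polynomial which expresses
`δ^n(x + y)` in terms of the `δ^i(x)` and `δ^i(y)`. -/
instance : Add (Witt p n R) :=
  ⟨fun a b => ofJet p n (eval ![a, b]) (MvPolynomial.X (0, 0) + MvPolynomial.X (1, 0))⟩

/-- The multiplication law: the `n`-th component of the product is `P_n`, the polynomial which
expresses `δ^n(x y)` in terms of the `δ^i(x)` and `δ^i(y)`. -/
instance : Mul (Witt p n R) :=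
  ⟨fun a b => ofJet p n (eval ![a, b]) (MvPolynomial.X (0, 0) * MvPolynomial.X (1, 0))⟩

instance : Neg (Witt p n R) :=
  ⟨fun a => ofJet p n (eval ![a]) (-MvPolynomial.X (0, 0))⟩

instance : Zero (Witt p n R) := ⟨⟨fun _ => 0⟩⟩

instance : One (Witt p n R) := ⟨⟨fun k => if k = 0 then 1 else 0⟩⟩

theorem eval_ofJet (f : JetPoly τ →+* R) (a : σ → Witt p n R) (q : σ → JetPoly τ)
    (ha : ∀ s, a s = ofJet p n f (q s)) {g : JetPoly σ}
    (hg : g ∈ MvPolynomial.supported ℤ {v : σ × ℕ | v.2 ≤ 0}) :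
    ofJet p n (eval a) g = ofJet p n f (substitute p q g) := by
  ext k
  simp only [ofJet]
  rw [← substitute_iterate_delta]
  have hk := iterate_delta_mem_supported p hg k
  have : ∀ h ∈ MvPolynomial.supported ℤ {v : σ × ℕ | v.2 ≤ (k : ℕ)},
      eval a h = f (substitute p q h) := by
    intro h hh
    induction hh using Algebra.adjoin_induction with
    | mem x hx =>
      obtain ⟨v, hv, rfl⟩ := hx
      have hv' : v.2 ≤ (k : ℕ) := hv
      have hlt : v.2 < n + 1 := by omega
      simp only [eval, substitute, MvPolynomial.coe_eval₂Hom, MvPolynomial.eval₂_X,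
        MvPolynomial.aeval_X, dif_pos hlt, ha, ofJet]
    | algebraMap r => simp
    | add x y _ _ hx hy => simp [hx, hy]
    | mul x y _ _ hx hy => simp [hx, hy]
  exact this _ hk

theorem X_mem (s : σ) :
    (MvPolynomial.X (s, 0) : JetPoly σ) ∈ MvPolynomial.supported ℤ {v : σ × ℕ | v.2 ≤ 0} :=
  Algebra.subset_adjoin ⟨(s, 0), le_refl 0, rfl⟩

theorem ofJet_add (f : JetPoly τ →+* R) (x y : JetPoly τ) :
    ofJet p n f (x + y) = ofJet p n f x + ofJet p n f y := by
  refine ((eval_ofJet p n f _ ![x, y] ?_ (add_mem (X_mem 0) (X_mem 1))).trans ?_).symm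
  · intro s; fin_cases s <;> rfl
  · simp [substitute]

theorem ofJet_mul (f : JetPoly τ →+* R) (x y : JetPoly τ) :
    ofJet p n f (x * y) = ofJet p n f x * ofJet p n f y := by
  refine ((eval_ofJet p n f _ ![x, y] ?_ (mul_mem (X_mem 0) (X_mem 1))).trans ?_).symm
  · intro s; fin_cases s <;> rfl
  · simp [substitute]

theorem ofJet_neg (f : JetPoly τ →+* R) (x : JetPoly τ) :
    ofJet p n f (-x) = -ofJet p n f x := by
  refine ((eval_ofJet p n f _ ![x] ?_ (neg_mem (X_mem 0))).trans ?_).symm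
  · intro s; fin_cases s; rfl
  · simp [substitute]

theorem delta_zero : delta p (0 : JetPoly τ) = 0 := by
  refine natCast_mul_cancel p ?_
  have := frob_eq p (0 : JetPoly τ)
  simp only [map_zero, zero_pow hp.out.ne_zero] at this
  linear_combination -this

theorem ofJet_zero (f : JetPoly τ →+* R) : ofJet p n f 0 = 0 := by
  have h : ∀ k, (delta p)^[k] (0 : JetPoly τ) = 0 := by
    intro k
    induction k with
    | zero => rfl
    | succ k ih => rw [Function.iterate_succ_apply, delta_zero, ih]
  ext k
  change f _ = 0
  rw [h, map_zero]

theorem ofJet_one (f : JetPoly τ →+* R) : ofJet p n f 1 = 1 := by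
  have h : ∀ k, (delta p)^[k] (0 : JetPoly τ) = 0 := by
    intro k
    induction k with
    | zero => rfl
    | succ k ih => rw [Function.iterate_succ_apply, delta_zero, ih]
  ext k
  change f _ = if k = 0 then 1 else 0
  obtain ⟨k, hk⟩ := k
  cases k with
  | zero => simp
  | succ k =>
    simp only [Function.iterate_succ_apply, delta_one, h, map_zero]
    simp

theorem ofJet_eval_X (a : σ → Witt p n R) (s : σ) :
    ofJet p n (eval a) (MvPolynomial.X (s, 0)) = a s := by
  have h : ∀ k, (delta p)^[k] (MvPolynomial.X (s, 0) : JetPoly σ) = MvPolynomial.X (s, k) := by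
    intro k
    induction k with
    | zero => rfl
    | succ k ih => rw [Function.iterate_succ_apply', ih, delta_X]
  ext k
  simp only [ofJet, h, eval, MvPolynomial.coe_eval₂Hom, MvPolynomial.eval₂_X, dif_pos k.2]

variable {p n} in
theorem exists_three (a b c : Witt p n R) : ∃ (f : JetPoly (Fin 3) →+* R) (x y z : JetPoly (Fin 3)),
    a = ofJet p n f x ∧ b = ofJet p n f y ∧ c = ofJet p n f z :=
  ⟨eval ![a, b, c], MvPolynomial.X (0, 0), MvPolynomial.X (1, 0), MvPolynomial.X (2, 0),
    (ofJet_eval_X p n ![a, b, c] 0).symm, (ofJet_eval_X p n ![a, b, c] 1).symm,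
    (ofJet_eval_X p n ![a, b, c] 2).symm⟩

instance : CommRing (Witt p n R) where
  add_assoc a b c := by
    obtain ⟨f, x, y, z, rfl, rfl, rfl⟩ := exists_three a b c
    simp only [← ofJet_add, add_assoc]
  zero_add a := by
    obtain ⟨f, x, -, -, rfl, -, -⟩ := exists_three a a a
    rw [← ofJet_zero p n f, ← ofJet_add, zero_add]
  add_zero a := by
    obtain ⟨f, x, -, -, rfl, -, -⟩ := exists_three a a a
    rw [← ofJet_zero p n f, ← ofJet_add, add_zero]
  add_comm a b := by
    obtain ⟨f, x, y, -, rfl, rfl, -⟩ := exists_three a b b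
    simp only [← ofJet_add, add_comm]
  neg_add_cancel a := by
    obtain ⟨f, x, -, -, rfl, -, -⟩ := exists_three a a a
    rw [← ofJet_neg, ← ofJet_add, neg_add_cancel, ofJet_zero]
  mul_assoc a b c := by
    obtain ⟨f, x, y, z, rfl, rfl, rfl⟩ := exists_three a b c
    simp only [← ofJet_mul, mul_assoc]
  one_mul a := by
    obtain ⟨f, x, -, -, rfl, -, -⟩ := exists_three a a a
    rw [← ofJet_one p n f, ← ofJet_mul, one_mul]
  mul_one a := by
    obtain ⟨f, x, -, -, rfl, -, -⟩ := exists_three a a a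
    rw [← ofJet_one p n f, ← ofJet_mul, mul_one]
  mul_comm a b := by
    obtain ⟨f, x, y, -, rfl, rfl, -⟩ := exists_three a b b
    simp only [← ofJet_mul, mul_comm]
  left_distrib a b c := by
    obtain ⟨f, x, y, z, rfl, rfl, rfl⟩ := exists_three a b c
    simp only [← ofJet_mul, ← ofJet_add, mul_add]
  right_distrib a b c := by
    obtain ⟨f, x, y, z, rfl, rfl, rfl⟩ := exists_three a b c
    simp only [← ofJet_mul, ← ofJet_add, add_mul]
  zero_mul a := by
    obtain ⟨f, x, -, -, rfl, -, -⟩ := exists_three a a a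
    rw [← ofJet_zero p n f, ← ofJet_mul, zero_mul]
  mul_zero a := by
    obtain ⟨f, x, -, -, rfl, -, -⟩ := exists_three a a a
    rw [← ofJet_zero p n f, ← ofJet_mul, mul_zero]
  nsmul := nsmulRec
  zsmul := zsmulRec

/-- `ofJet` as a ring homomorphism: the map `ℤ{x_s} → W_n(R)` induced by `f : ℤ{x_s} → R`. -/
def ofJetHom (f : JetPoly σ →+* R) : JetPoly σ →+* Witt p n R where
  toFun := ofJet p n f
  map_one' := ofJet_one p n f
  map_mul' := ofJet_mul p n f
  map_zero' := ofJet_zero p n f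
  map_add' := ofJet_add p n f

variable {p n} in
/-- A map out of `W_n(R)` is a ring homomorphism if its composites with the ring homomorphisms
`ℤ{x, y, z} → W_n(R)` induced by ring homomorphisms `ℤ{x, y, z} → R` are. -/
def mkHom {B : Type*} [CommRing B] (g : Witt p n R → B)
    (hg : ∀ f : JetPoly (Fin 3) →+* R,
      ∃ G : JetPoly (Fin 3) →+* B, ∀ q, g (ofJet p n f q) = G q) : Witt p n R →+* B where
  toFun := g
  map_one' := by
    obtain ⟨f, x, y, z, -, -, -⟩ := exists_three (1 : Witt p n R) 1 1
    obtain ⟨G, hG⟩ := hg f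
    rw [← ofJet_one p n f, hG, map_one]
  map_mul' a b := by
    obtain ⟨f, x, y, -, rfl, rfl, -⟩ := exists_three a b b
    obtain ⟨G, hG⟩ := hg f
    rw [← ofJet_mul, hG, hG, hG, map_mul]
  map_zero' := by
    obtain ⟨f, x, y, z, -, -, -⟩ := exists_three (0 : Witt p n R) 0 0
    obtain ⟨G, hG⟩ := hg f
    rw [← ofJet_zero p n f, hG, map_zero]
  map_add' a b := by
    obtain ⟨f, x, y, -, rfl, rfl, -⟩ := exists_three a b b
    obtain ⟨G, hG⟩ := hg f
    rw [← ofJet_add, hG, hG, hG, map_add]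

/-- Functoriality of `W_n`: componentwise application of a ring homomorphism. -/
def map {S : Type*} [CommRing S] (h : R →+* S) : Witt p n R →+* Witt p n S :=
  mkHom (fun a => ⟨fun k => h (a.coeff k)⟩) fun f => ⟨ofJetHom p n (h.comp f), fun _ => rfl⟩

/-- The truncation map `W_m(R) → W_n(R)`, `(x_0, …, x_m) ↦ (x_0, …, x_n)`, for `n ≤ m`. -/
def trunc {m n : ℕ} (h : n ≤ m) : Witt p m R →+* Witt p n R :=
  mkHom (fun a => ⟨fun k => a.coeff ⟨k, by omega⟩⟩) fun f => ⟨ofJetHom p n f, fun _ => rfl⟩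

/-- The projection `W_n(R) → R`, `(x_0, …, x_n) ↦ x_0`; for `n = 0` it identifies `W_0(R)`
with `R`. -/
def proj : Witt p n R →+* R :=
  mkHom (fun a => a.coeff 0) fun f => ⟨f, fun _ => rfl⟩

/-- The map `δ : W_(n+1)(R) → W_n(R)`, `(x_0, …, x_(n+1)) ↦ (x_1, …, x_(n+1))`. -/
def shift (a : Witt p (n + 1) R) : Witt p n R := ⟨fun k => a.coeff k.succ⟩

/-- The Frobenius `φ : W_(n+1)(R) → W_n(R)`, `φ(x) = τ(x)^p + p δ(x)`. -/
def phi : Witt p (n + 1) R →+* Witt p n R :=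
  mkHom (fun a => trunc p (Nat.le_succ n) a ^ p + p * shift p n a) fun f =>
    ⟨(ofJetHom p n f).comp (frob p (Fin 3)).toRingHom, fun q => by
      change ofJetHom p n f q ^ p + p * ofJetHom p n f (delta p q) = ofJetHom p n f (frob p _ q)
      rw [frob_eq, map_add, map_pow, map_mul, map_natCast]⟩

/-- The comultiplication `Δ : W_(m+n)(R) → W_n(W_m(R))`,
`(x_0, …, x_(m+n)) ↦ ((x_0, …, x_m), (x_1, …, x_(m+1)), …, (x_n, …, x_(m+n)))`. -/
def comul (m n : ℕ) : Witt p (m + n) R →+* Witt p n (Witt p m R) :=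
  mkHom (fun a => ⟨fun i => ⟨fun j => a.coeff ⟨i + j, by omega⟩⟩⟩) fun f =>
    ⟨ofJetHom p n (ofJetHom p m f), fun q => by
      ext i j
      change f ((delta p)^[(i : ℕ) + j] q) = f ((delta p)^[j] ((delta p)^[i] q))
      rw [add_comm, Function.iterate_add_apply]⟩

end Witt

end WittVectors

section JetSpaces

variable (p : ℕ) [hp : Fact p.Prime]

/-- The functor `W_n` on rings. -/
def wittFunctor (n : ℕ) : CommRingCat.{u} ⥤ CommRingCat.{u} where
  obj C := CommRingCat.of (Witt p n C)
  map g := CommRingCat.ofHom (Witt.map p n g.hom)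

/-- The truncation `W_m(C) → W_n(C)` for `n ≤ m`. -/
def truncHom {m n : ℕ} (h : n ≤ m) (C : CommRingCat.{u}) :
    (wittFunctor p m).obj C ⟶ (wittFunctor p n).obj C :=
  CommRingCat.ofHom (Witt.trunc p h)

/-- The projection `W_n(C) → C`. -/
def projHom (n : ℕ) (C : CommRingCat.{u}) : (wittFunctor p n).obj C ⟶ C :=
  CommRingCat.ofHom (Witt.proj p n)

/-- The Frobenius `W_(n+1)(C) → W_n(C)`. -/
def phiHom (n : ℕ) (C : CommRingCat.{u}) :
    (wittFunctor p (n + 1)).obj C ⟶ (wittFunctor p n).obj C :=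
  CommRingCat.ofHom (Witt.phi p n)

/-- The comultiplication `W_(m+n)(C) → W_n(W_m(C))`. -/
def comulHom (m n : ℕ) (C : CommRingCat.{u}) :
    (wittFunctor p (m + n)).obj C ⟶ (wittFunctor p n).obj ((wittFunctor p m).obj C) :=
  CommRingCat.ofHom (Witt.comul p m n)

theorem truncHom_naturality {m n : ℕ} (h : n ≤ m) {C D : CommRingCat.{u}} (g : C ⟶ D) :
    (wittFunctor p m).map g ≫ truncHom p h D = truncHom p h C ≫ (wittFunctor p n).map g := rfl

theorem projHom_naturality (n : ℕ) {C D : CommRingCat.{u}} (g : C ⟶ D) :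
    (wittFunctor p n).map g ≫ projHom p n D = projHom p n C ≫ g := rfl

theorem comulHom_naturality (m n : ℕ) {C D : CommRingCat.{u}} (g : C ⟶ D) :
    (wittFunctor p (m + n)).map g ≫ comulHom p m n D =
      comulHom p m n C ≫ (wittFunctor p n).map ((wittFunctor p m).map g) := rfl

theorem phiHom_naturality (n : ℕ) {C D : CommRingCat.{u}} (g : C ⟶ D) :
    (wittFunctor p (n + 1)).map g ≫ phiHom p n D = phiHom p n C ≫ (wittFunctor p n).map g := by
  have h : (wittFunctor p n).map g =
    CommRingCat.ofHom (Witt.map p n g.hom) := rfl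
  apply CommRingCat.hom_ext
  apply RingHom.ext
  intro a
  change Witt.trunc p (Nat.le_succ n) (Witt.map p (n + 1) g.hom a) ^ p +
      (p : Witt p _ _) * (Witt.shift p n (Witt.map p (n + 1) g.hom a) : Witt p n D) =
    Witt.map p n g.hom (Witt.trunc p (Nat.le_succ n) a ^ p + (p : Witt p _ _) * (Witt.shift p n a : Witt p n C))
  rw [map_add, map_mul, map_pow, map_natCast]
  rfl

theorem phiHom_trunc {m n : ℕ} (h : n ≤ m) (C : CommRingCat.{u}) :
    truncHom p (Nat.succ_le_succ h) C ≫ phiHom p n C = phiHom p m C ≫ truncHom p h C := by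
  apply CommRingCat.hom_ext
  apply RingHom.ext
  intro a
  change (Witt.trunc p (Nat.le_succ n) (Witt.trunc p (Nat.succ_le_succ h) a) : Witt p n C) ^ p +
      (p : Witt p _ _) * (Witt.shift p n (Witt.trunc p (Nat.succ_le_succ h) a) : Witt p n C) =
    Witt.trunc p h ((Witt.trunc p (Nat.le_succ m) a : Witt p m C) ^ p + (p : Witt p _ _) * (Witt.shift p m a : Witt p m C))
  rw [map_add, map_mul, map_pow, map_natCast]
  rfl

/-- Presheaves of sets on the category `Aff` of affine schemes, written as covariant functors
on commutative rings: the value at `C` is the value of the presheaf at `Spec(C)`. -/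
abbrev AffPresheaf : Type (u + 1) := CommRingCat.{u} ⥤ Type u

/-- The set `J(X)(C) = lim_n X(W_n(C))`: compatible families of elements of the `X(W_n(C))`. -/
structure JetPoint (X : AffPresheaf.{u}) (C : CommRingCat.{u}) : Type u where
  /-- The element of `X(W_n(C))`. -/
  val : ∀ n : ℕ, X.obj ((wittFunctor p n).obj C)
  compat : ∀ (m n : ℕ) (h : n ≤ m), X.map (truncHom p h C) (val m) = val n

theorem JetPoint.ext {p : ℕ} [Fact p.Prime] {X : AffPresheaf.{u}} {C : CommRingCat.{u}}
    {a b : JetPoint p X C} (h : a.val = b.val) : a = b := by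
  cases a
  cases b
  cases h
  rfl

/-- The arithmetic jet space `J(X)` of a presheaf `X`, given by `J(X)(C) = lim_n X(W_n(C))`. -/
def jetObj (X : AffPresheaf.{u}) : AffPresheaf.{u} where
  obj C := JetPoint p X C
  map {C D} g := ↾fun a => (⟨fun n => X.map ((wittFunctor p n).map g) (a.val n), fun m n h => by
    rw [← Functor.map_comp_apply, truncHom_naturality, Functor.map_comp_apply, a.compat m n h]⟩ :
      JetPoint p X D)
  map_id C := by
    ext a
    apply JetPoint.ext
    funext n
    change X.map (𝟙 _) (a.val n) = a.val n
    simp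
  map_comp g h := by
    ext a
    apply JetPoint.ext
    funext n
    change X.map ((wittFunctor p n).map g ≫ (wittFunctor p n).map h) (a.val n) = _
    rw [Functor.map_comp_apply]
    rfl

/-- Functoriality of `J`. -/
def jetMap {X Y : AffPresheaf.{u}} (f : X ⟶ Y) : jetObj p X ⟶ jetObj p Y where
  app C := ↾fun a => (⟨fun n => f.app _ (a.val n), fun m n h => by
    rw [← NatTrans.naturality_apply, a.compat m n h]⟩ : JetPoint p Y C)
  naturality C D g := by
    ext a
    apply JetPoint.ext
    funext n
    exact NatTrans.naturality_apply f _ _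

/-- The functor `J`. -/
def jetFunctor : AffPresheaf.{u} ⥤ AffPresheaf.{u} where
  obj := jetObj p
  map := jetMap p
  map_id _ := rfl
  map_comp _ _ := rfl

/-- The projection `u : J(X) → J^0(X) = X`. -/
def jetCounit (X : AffPresheaf.{u}) : jetObj p X ⟶ X where
  app C := ↾fun a : JetPoint p X C => X.map (projHom p 0 C) (a.val 0)
  naturality C D g := by
    ext a
    change X.map (projHom p 0 D) (X.map ((wittFunctor p 0).map g) (a.val 0)) =
      X.map g (X.map (projHom p 0 C) (a.val 0))
    rw [← Functor.map_comp_apply, ← Functor.map_comp_apply, projHom_naturality]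

/-- The comultiplication `ν : J(X) → J(J(X))`, the limit of the maps
`J^(m+n)(X) → J^m(J^n(X))` induced by `Δ : W_(m+n)(C) → W_n(W_m(C))`. -/
def jetComul (X : AffPresheaf.{u}) : jetObj p X ⟶ jetObj p (jetObj p X) where
  app C := ↾fun a : JetPoint p X C =>
    (⟨fun m => (⟨fun n => X.map (comulHom p m n C) (a.val (m + n)), fun n n' h => by
        rw [← a.compat (m + n) (m + n') (by omega), ← Functor.map_comp_apply,
          ← Functor.map_comp_apply]
        rfl⟩ : JetPoint p X ((wittFunctor p m).obj C)), fun m m' h => by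
        apply JetPoint.ext
        funext n
        change X.map ((wittFunctor p n).map (truncHom p h C))
          (X.map (comulHom p m n C) (a.val (m + n))) = X.map (comulHom p m' n C) (a.val (m' + n))
        rw [← a.compat (m + n) (m' + n) (by omega), ← Functor.map_comp_apply,
          ← Functor.map_comp_apply]
        rfl⟩ : JetPoint p (jetObj p X) C)
  naturality C D g := by
    ext a
    apply JetPoint.ext
    funext m
    apply JetPoint.ext
    funext n
    change X.map (comulHom p m n D) (X.map ((wittFunctor p (m + n)).map g) (a.val (m + n))) =
      X.map ((wittFunctor p n).map ((wittFunctor p m).map g))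
        (X.map (comulHom p m n C) (a.val (m + n)))
    rw [← Functor.map_comp_apply, ← Functor.map_comp_apply, comulHom_naturality]

/-- The comonad `J`. -/
def jet : Comonad AffPresheaf.{u} where
  toFunctor := jetFunctor p
  ε :=
    { app := jetCounit p
      naturality := fun X Y f => by
        ext C a
        exact NatTrans.naturality_apply f _ _ |>.symm }
  δ :=
    { app := jetComul p
      naturality := fun X Y f => by
        ext C a
        apply JetPoint.ext
        funext m
        apply JetPoint.ext
        funext n
        exact NatTrans.naturality_apply f _ _ |>.symm }
  coassoc X := by
    ext C a
    apply JetPoint.ext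
    funext l
    apply JetPoint.ext
    funext m
    apply JetPoint.ext
    funext n
    change X.map (comulHom p m n _) (X.map (comulHom p l (m + n) C) (a.val (l + (m + n)))) =
      X.map ((wittFunctor p n).map (comulHom p l m C))
        (X.map (comulHom p (l + m) n C) (a.val (l + m + n)))
    rw [← a.compat (l + (m + n)) (l + m + n) (by omega), ← Functor.map_comp_apply,
      ← Functor.map_comp_apply, ← Functor.map_comp_apply]
    congr 3
    apply CommRingCat.hom_ext
    apply RingHom.ext
    intro x
    refine Witt.ext (funext fun i => Witt.ext (funext fun j => Witt.ext (funext fun k => ?_)))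
    change x.coeff ⟨(i + j : ℕ) + k, _⟩ = x.coeff ⟨i + (j + k : ℕ), _⟩
    congr 2
    omega
  left_counit X := by
    ext C a
    apply JetPoint.ext
    funext n
    change X.map ((wittFunctor p n).map (projHom p 0 C))
      (X.map (comulHom p 0 n C) (a.val (0 + n))) = a.val n
    rw [← a.compat (0 + n) n (by omega), ← Functor.map_comp_apply]
    rfl
  right_counit X := by
    ext C a
    apply JetPoint.ext
    funext m
    change X.map (projHom p 0 _) (X.map (comulHom p m 0 C) (a.val (m + 0))) = a.val m
    rw [← a.compat (m + 0) m (by omega), ← Functor.map_comp_apply]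
    congr 3
    apply CommRingCat.hom_ext
    apply RingHom.ext
    intro x
    refine Witt.ext (funext fun i => ?_)
    change x.coeff ⟨0 + (i : ℕ), _⟩ = x.coeff ⟨i, _⟩
    congr 2
    omega

/-- The Frobenius lift `φ_{J(X)} : J(X) → J(X)`, the limit of the maps `J^(n+1)(X) → J^n(X)`
induced by `φ : W_(n+1)(C) → W_n(C)`. -/
def jetFrobenius (X : AffPresheaf.{u}) : jetObj p X ⟶ jetObj p X where
  app C := ↾fun a : JetPoint p X C =>
    (⟨fun n => X.map (phiHom p n C) (a.val (n + 1)), fun m n h => by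
      rw [← a.compat (m + 1) (n + 1) (by omega), ← Functor.map_comp_apply,
        ← Functor.map_comp_apply, phiHom_trunc p h]⟩ : JetPoint p X C)
  naturality C D g := by
    ext a
    apply JetPoint.ext
    funext n
    change X.map (phiHom p n D) (X.map ((wittFunctor p (n + 1)).map g) (a.val (n + 1))) =
      X.map ((wittFunctor p n).map g) (X.map (phiHom p n C) (a.val (n + 1)))
    rw [← Functor.map_comp_apply, ← Functor.map_comp_apply, phiHom_naturality]

end JetSpaces

section Sheaves

/-- The étale topology on the category `Aff` of affine schemes: it is generated by the jointly
surjective families of étale morphisms of affine schemes. -/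
def etaleTopologyAff : GrothendieckTopology CommRingCat.{u}ᵒᵖ :=
  (AlgebraicGeometry.Scheme.etalePrecoverage.{u}.comap
    AlgebraicGeometry.Scheme.Spec.{u}).toGrothendieck

/-- The presheaves on `Aff` which are sheaves for the étale topology. -/
def IsEtaleSheaf : ObjectProperty AffPresheaf.{u} := fun X =>
  Presheaf.IsSheaf etaleTopologyAff.{u} (unopUnop CommRingCat.{u} ⋙ X)

/-- The functor sending a ring `R` to the abelian group `R[p]` of its `p`-torsion elements. -/
def torsionFunctor (p : ℕ) : CommRingCat.{u} ⥤ AddCommGrpCat.{u} where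
  obj R := AddCommGrpCat.of (AddSubgroup.torsionBy R (p : ℤ))
  map {R S} f := AddCommGrpCat.ofHom
    ((f.hom.toAddMonoidHom.comp (AddSubgroup.torsionBy R (p : ℤ)).subtype).codRestrict
      (AddSubgroup.torsionBy S (p : ℤ)) fun x => by
        have hx := x.2
        change (p : ℤ) • (x : R) = 0 at hx
        change (p : ℤ) • f.hom (x : R) = 0
        rw [← map_zsmul, hx, map_zero])

/-- A pro-abelian group `(G_i)_{i ∈ I}`, indexed by a small cofiltered category `Iᵒᵖ`, is
isomorphic to the zero pro-abelian group. The category of pro-abelian groups is the opposite of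
the category of ind-objects of the opposite of the category of abelian groups. -/
def IsProZero {I : Type u} [SmallCategory I] [IsFiltered I] (G : Iᵒᵖ ⥤ AddCommGrpCat.{u}) : Prop :=
  IsZero (op ((Ind.lim I).obj G.rightOp) : (Ind AddCommGrpCat.{u}ᵒᵖ)ᵒᵖ)

theorem isZero_indYoneda {C : Type (u + 1)} [Category.{u} C] [HasFiniteColimits C] [HasLimits C]
    {Z : C} (hZ : IsZero Z) :
    IsZero (Ind.yoneda.obj Z : Ind C) := by
  have hI : IsInitial (Ind.yoneda.obj Z : Ind C) := IsInitial.isInitialObj Ind.yoneda _ hZ.isInitial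
  have hT : IsTerminal (Ind.yoneda.obj Z : Ind C) := IsTerminal.isTerminalObj Ind.yoneda _ hZ.isTerminal
  exact ⟨fun Y => ⟨⟨⟨hI.to Y⟩, fun _ => hI.hom_ext _ _⟩⟩, fun Y => ⟨⟨⟨hT.from Y⟩, fun _ => hT.hom_ext _ _⟩⟩⟩

/-- A pro-abelian group is isomorphic to zero if and only if for every index `i` there is a
transition map `G_j → G_i` which is zero. -/
theorem isProZero_iff {I : Type u} [SmallCategory I] [IsFiltered I] (G : Iᵒᵖ ⥤ AddCommGrpCat.{u}) :
    IsProZero G ↔ ∀ i : I, ∃ (j : I) (f : i ⟶ j), G.map f.op = 0 := by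
  have h0 : IsZero (Ind.yoneda.obj (op (AddCommGrpCat.of PUnit.{u+1})) : Ind AddCommGrpCat.{u}ᵒᵖ) :=
    isZero_indYoneda (AddCommGrpCat.isZero_of_subsingleton _).op
  let F := G.rightOp ⋙ (Ind.yoneda : AddCommGrpCat.{u}ᵒᵖ ⥤ _)
  have hL : IsProZero G ↔ IsZero (colimit F) := ⟨fun h => h.unop, fun h => h.op⟩
  rw [hL]
  constructor
  · intro h i
    let Φ : Ind AddCommGrpCat.{u}ᵒᵖ ⥤ Type u :=
      Ind.inclusion _ ⋙ (evaluation _ _).obj (op (G.rightOp.obj i))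
    have hc := isColimitOfPreserves Φ (colimit.isColimit F)
    let e := Ind.yonedaCompInclusion (C := AddCommGrpCat.{u}ᵒᵖ)
    let s : (G.rightOp.obj i ⟶ G.rightOp.obj i) → Φ.obj (F.obj i) := fun x =>
      (e.inv.app (G.rightOp.obj i)).app (op (G.rightOp.obj i)) x
    have hs : ∀ (j : I) (f : i ⟶ j) (x : G.rightOp.obj i ⟶ G.rightOp.obj i),
      (e.hom.app (G.rightOp.obj j)).app (op (G.rightOp.obj i)) (Φ.map (F.map f) (s x)) =
        x ≫ G.rightOp.map f := by
      intro j f x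
      have h1 := congrArg (fun t => t.app (op (G.rightOp.obj i)) (s x))
        (e.hom.naturality (G.rightOp.map f))
      have h2 := congrArg (fun t => (t.app (G.rightOp.obj i)).app (op (G.rightOp.obj i)) x)
        e.inv_hom_id
      refine h1.trans ?_
      change (yoneda.map (G.rightOp.map f)).app _ ((e.hom.app (G.rightOp.obj i)).app (op (G.rightOp.obj i)) (s x)) = _
      change (e.hom.app (G.rightOp.obj i)).app (op (G.rightOp.obj i)) (s x) = x at h2
      rw [h2]
      rfl
    have key : Φ.map (colimit.ι F i) (s (𝟙 _)) = Φ.map (colimit.ι F i) (s 0) := by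
      have h3 : ∀ (x), s x = Φ.map (Ind.yoneda.map x) (s (𝟙 _)) := by
        intro x
        have h1 := congrArg (fun t => t.app (op (G.rightOp.obj i)) (𝟙 _))
          (e.inv.naturality x)
        refine Eq.trans ?_ h1
        change _ = (e.inv.app (G.rightOp.obj i)).app (op (G.rightOp.obj i)) (𝟙 _ ≫ x)
        rw [Category.id_comp]
      rw [h3 0, ← Functor.map_comp_apply]
      congr 2
      exact congrArg Φ.map (h.eq_of_tgt _ _)
    obtain ⟨j, f, hf⟩ := (Types.FilteredColimit.isColimit_eq_iff' hc _ _).1 key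
    refine ⟨j, f, ?_⟩
    have := congrArg ((e.hom.app (G.rightOp.obj j)).app (op (G.rightOp.obj i))) hf
    have h4 := (hs j f (𝟙 _)).symm.trans (this.trans (hs j f 0))
    rw [Category.id_comp, zero_comp] at h4
    exact congrArg Quiver.Hom.unop h4
  · intro h
    have hid : ∀ i, ∃ (a : F.obj i ⟶ Ind.yoneda.obj (op (AddCommGrpCat.of PUnit.{u+1}))) (b : Ind.yoneda.obj (op (AddCommGrpCat.of PUnit.{u+1})) ⟶ colimit F), colimit.ι F i = a ≫ b := by
      intro i
      obtain ⟨j, f, hf⟩ := h i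
      refine ⟨Ind.yoneda.map 0, Ind.yoneda.map (0 : op (AddCommGrpCat.of PUnit.{u+1}) ⟶ G.rightOp.obj j) ≫ colimit.ι F j, ?_⟩
      rw [← Category.assoc, ← Functor.map_comp, ← colimit.w F f]
      congr 1
      change Ind.yoneda.map _ = _
      congr 1
      rw [zero_comp]
      exact congrArg Quiver.Hom.op hf
    have hsub : ∀ {Y} (g g' : colimit F ⟶ Y), g = g' := by
      intro Y g g'
      refine colimit.hom_ext fun i => ?_
      obtain ⟨a, b, hab⟩ := hid i
      rw [hab, Category.assoc, Category.assoc, h0.eq_of_src (b ≫ g) (b ≫ g')]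
    exact h0.of_iso ⟨h0.from_ _, h0.to_ _, hsub _ _, h0.eq_of_src _ _⟩

/-- A presheaf on `Aff` is `p`-torsion free ind-affine if it is of the form `colim_i Spec(R_i)` for
a small filtered diagram of affine schemes `Spec(R_i)` such that the pro-abelian group
`(R_i[p])_i` is isomorphic to zero. As all affine schemes are quasi-compact and quasi-separated,
the filtered colimit is the same in presheaves and in étale sheaves. The functor of points of `Spec(R)` is `coyoneda.obj (op R)`. -/
def IsPTorsionFreeIndAffine (p : ℕ) : ObjectProperty AffPresheaf.{u} := fun X =>
  ∃ (I : Type u) (_ : SmallCategory I) (_ : IsFiltered I) (R : Iᵒᵖ ⥤ CommRingCat.{u})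
    (ι : R.rightOp ⋙ coyoneda ⟶ (Functor.const I).obj X),
    Nonempty (IsColimit (Cocone.mk X ι)) ∧ IsProZero (R ⋙ torsionFunctor p)

/-- An endomorphism `φ` of `X` is a lift of the Frobenius if its restriction to
`X × Spec(𝔽_p)` is the Frobenius: for every ring `C` in which `p = 0`, with Frobenius
endomorphism `F : C → C`, the maps `φ` and `X(F)` from `X(C)` to itself agree. -/
def IsFrobeniusLift (p : ℕ) {X : AffPresheaf.{u}} (φ : X ⟶ X) : Prop :=
  ∀ (C : CommRingCat.{u}) (F : C ⟶ C), (p : C) = 0 → (∀ x : C, F x = x ^ p) →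
    φ.app C = X.map F

/-- A sheaf equipped with a lift of the Frobenius. -/
structure FrobeniusSheaf (p : ℕ) : Type (u + 1) where
  /-- The underlying sheaf. -/
  X : AffPresheaf.{u}
  isSheaf : IsEtaleSheaf X
  /-- The lift of the Frobenius. -/
  φ : X ⟶ X
  isFrobeniusLift : IsFrobeniusLift p φ

/-- A morphism of sheaves equipped with a lift of the Frobenius. -/
@[ext]
structure FrobeniusSheaf.Hom {p : ℕ} (X Y : FrobeniusSheaf.{u} p) : Type (u + 1) where
  /-- The underlying morphism of sheaves. -/
  f : X.X ⟶ Y.X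
  comm : X.φ ≫ f = f ≫ Y.φ

instance (p : ℕ) : Category (FrobeniusSheaf.{u} p) where
  Hom X Y := FrobeniusSheaf.Hom X Y
  id X := ⟨𝟙 X.X, by simp⟩
  comp f g := ⟨f.f ≫ g.f, by rw [← Category.assoc, f.comm, Category.assoc, g.comm,
    Category.assoc]⟩

variable (p : ℕ) [hp : Fact p.Prime]

/-- The category of `δ`-sheaves: étale sheaves `X` with a co-action `α : X → J(X)` of the
comonad `J`. A `δ`-morphism is a morphism of sheaves compatible with the co-actions. -/
abbrev DeltaSheaf : Type (u + 1) :=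
  ObjectProperty.FullSubcategory fun A : (jet.{u} p).Coalgebra => IsEtaleSheaf A.A

variable {p}

/-- The morphism `φ_X : X → J(X) → J(X) → X` attached to a morphism `α : X → J(X)`. -/
def frobeniusOf {X : AffPresheaf.{u}} (α : X ⟶ jetObj p X) : X ⟶ X :=
  α ≫ jetFrobenius p X ≫ jetCounit p X

theorem isFrobeniusLift_frobeniusOf (A : (jet.{u} p).Coalgebra) :
    IsFrobeniusLift p (frobeniusOf A.a) := by
  intro C F hC hF
  ext x
  have hcounit : A.A.map (projHom p 0 C) ((A.a.app C x : JetPoint p A.A C).val 0) = x := by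
    have h := congrArg (fun f : A.A ⟶ A.A => f.app C x) A.counit
    exact h
  have hphi : phiHom p 0 C ≫ projHom p 0 C =
      truncHom p (Nat.zero_le 1) C ≫ projHom p 0 C ≫ F := by
    apply CommRingCat.hom_ext
    apply RingHom.ext
    intro a
    change Witt.proj p 0 ((Witt.trunc p (Nat.zero_le 1) a : Witt p 0 C) ^ p +
      (p : Witt p _ _) * (Witt.shift p 0 a : Witt p 0 C)) = F (Witt.proj p 0 (Witt.trunc p (Nat.zero_le 1) a))
    rw [map_add, map_mul, map_pow, map_natCast, hC, zero_mul, add_zero, hF]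
  change A.A.map (projHom p 0 C)
    (A.A.map (phiHom p 0 C) ((A.a.app C x : JetPoint p A.A C).val (0 + 1))) = A.A.map F x
  conv_rhs => rw [← hcounit, ← (A.a.app C x : JetPoint p A.A C).compat (0 + 1) 0 (by omega)]
  rw [← Functor.map_comp_apply, hphi, Functor.map_comp_apply, Functor.map_comp_apply]

theorem frobeniusOf_naturality {X Y : AffPresheaf.{u}} {α : X ⟶ jetObj p X} {β : Y ⟶ jetObj p Y}
    {f : X ⟶ Y} (h : α ≫ jetMap p f = f ≫ β) : frobeniusOf α ≫ f = f ≫ frobeniusOf β := by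
  have h1 : jetFrobenius p X ≫ jetMap p f = jetMap p f ≫ jetFrobenius p Y := by
    ext C a
    apply JetPoint.ext
    funext n
    exact NatTrans.naturality_apply f _ _
  have h2 : jetCounit p X ≫ f = jetMap p f ≫ jetCounit p Y :=
    ((jet p).ε.naturality f).symm
  simp only [frobeniusOf, Category.assoc]
  rw [h2, reassoc_of% h1, reassoc_of% h]

variable (p)

/-- The forgetful functor from `δ`-sheaves to sheaves equipped with a lift of the Frobenius. -/
def forgetToFrobenius : DeltaSheaf.{u} p ⥤ FrobeniusSheaf.{u} p where
  obj A := ⟨A.obj.A, A.property, frobeniusOf A.obj.a, isFrobeniusLift_frobeniusOf A.obj⟩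
  map f := ⟨f.hom.f, frobeniusOf_naturality f.hom.h⟩

/-- The category of `p`-torsion free ind-affine `δ`-sheaves. -/
abbrev PTorsionFreeIndAffineDeltaSheaf : Type (u + 1) :=
  ObjectProperty.FullSubcategory fun A : DeltaSheaf.{u} p => IsPTorsionFreeIndAffine p A.obj.A

/-- The category of `p`-torsion free ind-affine sheaves equipped with a lift of the Frobenius. -/
abbrev PTorsionFreeIndAffineFrobeniusSheaf : Type (u + 1) :=
  ObjectProperty.FullSubcategory fun X : FrobeniusSheaf.{u} p => IsPTorsionFreeIndAffine p X.X

/-- The forgetful functor from `p`-torsion free ind-affine `δ`-sheaves to `p`-torsion free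
ind-affine sheaves equipped with a lift of the Frobenius. -/
def forgetPTorsionFreeIndAffine :
    PTorsionFreeIndAffineDeltaSheaf.{u} p ⥤ PTorsionFreeIndAffineFrobeniusSheaf.{u} p :=
  ObjectProperty.lift _ (ObjectProperty.ι _ ⋙ forgetToFrobenius p) fun A => A.property

end Sheaves

end

end DeltaSheaves

namespace DeltaSheaves

open CategoryTheory Limits Opposite

set_option linter.unusedSectionVars false

noncomputable section

/-! ### Exactness and torsion-killing lifts for ind-affine presheaves. -/

section LeftExact

/-! A filtered colimit of representables commutes with finite limits, so `X` carries fibre products,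
equalizers and injections of rings to those of sets. Triviality of the pro-torsion means that every
point `x` of `X(C)` comes from a point `d` over some `D` along a map `h : D → C` with `h(D[p]) = 0`
(`HasTorsionKillingLifts`).

The ghost map from `W_1(D)` to the ring of pairs `(a, b)` with `b ≡ a^p` modulo `p`, given by `(x_0,
x_1) ↦ (x_0, x_0^p + p x_1)`, is surjective with kernel the `(0, x_1)` with `p x_1 = 0`. Hence
`W_1(h)` factors through the ring of pairs (`exists_ghostRing_to_witt`). If `φ` lifts the Frobenius,
then `(d, φ(d))` is a point of `X` over that ring, and its image over `W_1(C)` is a lift of `x`. Two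
choices of `(D, d, h)` are compared over `D ×_C D'` (`IsLiftOf.unique`), so `φ` yields a natural
section `X(C) → X(W_1(C))`.

Such a section determines a whole co-action. Indeed `W_(n+2)(C)` is the equalizer of two maps
`W_1(W_(n+1)(C)) ⇉ W_1(W_n(C))` (`comulHom_one_equalizer`), so the section can be iterated, and
above each `x` there is exactly one horizontal point over `W_n(C)`. Naturality and coassociativity
follow from this uniqueness (`IsHorizontal.ext`), which gives essential surjectivity.

For fullness, a morphism commuting with the Frobenius lifts respects the `W_1`-components, because
after a torsion-killing map these are determined by their ghost components (`map_witt_one_ext`);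
horizontality propagates this to all `W_n`. Faithfulness holds because morphisms on both sides are
sheaf morphisms subject to a condition. -/

theorem preservesFiniteLimits_of_isPTorsionFreeIndAffine {p : ℕ} {X : AffPresheaf.{u}}
    (hX : IsPTorsionFreeIndAffine p X) : PreservesFiniteLimits X := by
  obtain ⟨I, _, _, R, ι, ⟨hι⟩, -⟩ := hX
  -- Each representable preserves limits, limits of functors are computed pointwise, and filtered
  -- colimits of sets commute with finite limits.
  have : PreservesFiniteLimits (R.rightOp ⋙ coyoneda).flip :=
    ⟨fun J _ _ => preservesLimitsOfShape_of_evaluation _ _ fun i =>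
      inferInstanceAs (PreservesLimitsOfShape J (coyoneda.obj (R.rightOp.obj i)))⟩
  have : PreservesFiniteLimits ((R.rightOp ⋙ coyoneda).flip ⋙ colim) :=
    comp_preservesFiniteLimits _ _
  exact preservesFiniteLimits_of_natIso
    ((colimitIsoFlipCompColim _).symm ≪≫ (colimit.isColimit _).coconePointUniqueUpToIso hι)

/-- Each point of `X` over `C` comes from a point over some `D` along a homomorphism `D → C`
which annihilates the `p`-torsion of `D`. -/
def HasTorsionKillingLifts (p : ℕ) (X : AffPresheaf.{u}) : Prop :=
  ∀ (C : CommRingCat.{u}) (x : X.obj C), ∃ (D : CommRingCat.{u}) (d : X.obj D) (h : D ⟶ C),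
    (∀ r : D, (p : D) * r = 0 → h r = 0) ∧ X.map h d = x

/-- A point comes from some `c : R_i → C`. With `R_j[p] → R_i[p]` zero, the lift is the tautological
point over `D = R_j`, along `R_j → R_i → C`. -/
theorem hasTorsionKillingLifts_of_isPTorsionFreeIndAffine {p : ℕ} {X : AffPresheaf.{u}}
    (hX : IsPTorsionFreeIndAffine p X) : HasTorsionKillingLifts p X := by
  obtain ⟨I, _, _, R, ι, ⟨hι⟩, hR⟩ := hX
  intro C x
  obtain ⟨i, c, rfl⟩ := FunctorToTypes.jointly_surjective _ C hι x
  obtain ⟨j, f, hf⟩ := (isProZero_iff _).1 hR i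
  let pt : ((R.rightOp ⋙ coyoneda).obj j).obj (R.obj (op j)) := 𝟙 (R.obj (op j))
  let c' : R.obj (op i) ⟶ C := c
  refine ⟨R.obj (op j), (ι.app j).app _ pt, R.map f.op ≫ c', ?_, ?_⟩
  · intro r hr
    have hr' : r ∈ AddSubgroup.torsionBy (R.obj (op j)) (p : ℤ) := by
      change (p : ℤ) • r = 0
      rw [zsmul_eq_mul, Int.cast_natCast, hr]
    have h0 : R.map f.op r = 0 :=
      congrArg Subtype.val (congrArg (fun g => g.hom ⟨r, hr'⟩) hf)
    change c' (R.map f.op r) = 0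
    rw [h0, map_zero]
  · have h1 := (NatTrans.naturality_apply (ι.app j) (R.map f.op ≫ c') pt).symm
    have h2 : (ι.app j).app C (R.map f.op ≫ c') = (ι.app i).app C c :=
      congrArg (fun t => t.app C c) (ι.naturality f)
    have h3 : ((R.rightOp ⋙ coyoneda).obj j).map (R.map f.op ≫ c') pt = R.map f.op ≫ c' :=
      Category.id_comp (R.map f.op ≫ c')
    rw [h3, h2] at h1
    exact h1

variable (X : AffPresheaf.{u}) [PreservesFiniteLimits X]

theorem map_injective_of_injective {A B : CommRingCat.{u}} (h : A ⟶ B)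
    (hh : Function.Injective h) : Function.Injective (X.map h) :=
  have := ConcreteCategory.mono_of_injective h hh
  (mono_iff_injective _).1 inferInstance

theorem exists_map_pullback {A B P Q : CommRingCat.{u}} {f : P ⟶ A} {g : P ⟶ B} {h : A ⟶ Q}
    {k : B ⟶ Q} (H : IsPullback f g h k) (a : X.obj A) (b : X.obj B)
    (hab : X.map h a = X.map k b) : ∃ y : X.obj P, X.map f y = a ∧ X.map g y = b :=
  Types.exists_of_isPullback (H.map X) a b hab

theorem pullback_ext {A B P Q : CommRingCat.{u}} {f : P ⟶ A} {g : P ⟶ B} {h : A ⟶ Q}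
    {k : B ⟶ Q} (H : IsPullback f g h k) {y y' : X.obj P} (hf : X.map f y = X.map f y')
    (hg : X.map g y = X.map g y') : y = y' :=
  Types.ext_of_isPullback (H.map X) hf hg

theorem exists_map_equalizer {E A B : CommRingCat.{u}} (e : E ⟶ A) (f g : A ⟶ B)
    (he : Function.Injective e) (hfg : ∀ a : A, f a = g a ↔ ∃ z, e z = a) (a : X.obj A)
    (ha : X.map f a = X.map g a) : ∃ y : X.obj E, X.map e y = a := by
  have w : e ≫ f = e ≫ g := by
    ext z
    exact (hfg (e z)).2 ⟨z, rfl⟩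
  have hl : IsLimit (Fork.ofι e w) := by
    -- The forgetful functor to sets reflects limits, so the equalizer may be checked on elements.
    refine isLimitOfIsLimitForkMap (forget CommRingCat.{u}) w ?_
    refine Nonempty.some ((Types.type_equalizer_iff_unique _ _).2 ?_)
    intro a ha
    obtain ⟨z, hz⟩ := (hfg a).1 ha
    exact ⟨z, hz, fun z' hz' => he (hz'.trans hz.symm)⟩
  obtain ⟨y, hy, -⟩ := (Types.type_equalizer_iff_unique _ _).1
    ⟨isLimitForkMapOfIsLimit X w hl⟩ a ha
  exact ⟨y, hy⟩

end LeftExact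

/-! ### The ghost map on Witt vectors of length two. -/

section Ghost

variable (p : ℕ) [hp : Fact p.Prime]

/-- The Frobenius endomorphism of a ring in which `p = 0`. -/
def frobeniusHom (C : CommRingCat.{u}) (hC : (p : C) = 0) : C ⟶ C :=
  CommRingCat.ofHom
    { powMonoidWithZeroHom (M₀ := C) hp.out.ne_zero with
      map_add' := fun x y => by
        obtain ⟨r, hr⟩ := exists_add_pow_prime_eq hp.out x y
        change (x + y) ^ p = x ^ p + y ^ p
        rw [hr, hC]
        ring }

/-- The reduction `C/p`. -/
abbrev modP (C : CommRingCat.{u}) : CommRingCat.{u} :=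
  CommRingCat.of (C ⧸ Ideal.span {(p : C)})

/-- The quotient map `C → C/p`. -/
def toModP (C : CommRingCat.{u}) : C ⟶ modP p C :=
  CommRingCat.ofHom (Ideal.Quotient.mk _)

theorem natCast_modP (C : CommRingCat.{u}) : (p : modP p C) = 0 := by
  have h : toModP p C (p : C) = 0 :=
    Ideal.Quotient.eq_zero_iff_mem.2 (Ideal.mem_span_singleton_self _)
  rwa [map_natCast] at h

theorem toModP_eq_iff (C : CommRingCat.{u}) (a b : C) :
    toModP p C a = toModP p C b ↔ (p : C) ∣ a - b :=
  Ideal.Quotient.eq.trans Ideal.mem_span_singleton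

/-- The composite of `C → C/p` with the Frobenius of `C/p`. -/
def toModPFrobenius (C : CommRingCat.{u}) : C ⟶ modP p C :=
  toModP p C ≫ frobeniusHom p (modP p C) (natCast_modP p C)

/-- The map `W_1(C) → C`, `(x_0, x_1) ↦ x_0 ^ p + p x_1`. -/
def ghostHom (C : CommRingCat.{u}) : (wittFunctor p 1).obj C ⟶ C :=
  phiHom p 0 C ≫ projHom p 0 C

theorem ghostHom_apply (C : CommRingCat.{u}) (w : Witt p 1 C) :
    ghostHom p C w = w.coeff 0 ^ p + (p : C) * w.coeff 1 := by
  change Witt.proj p 0 ((Witt.trunc p (Nat.zero_le 1) w : Witt p 0 C) ^ p +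
    (p : Witt p _ _) * (Witt.shift p 0 w : Witt p 0 C)) = _
  rw [map_add, map_mul, map_pow, map_natCast]
  rfl

theorem ghostHom_naturality {C D : CommRingCat.{u}} (g : C ⟶ D) :
    (wittFunctor p 1).map g ≫ ghostHom p D = ghostHom p C ≫ g := by
  rw [ghostHom, ← Category.assoc, phiHom_naturality, Category.assoc, projHom_naturality,
    ghostHom, Category.assoc]

/-- The ring of pairs `(a, b)` of elements of `C` with `b ≡ a ^ p` modulo `p`. -/
def ghostRing (C : CommRingCat.{u}) : CommRingCat.{u} :=
  (CommRingCat.pullbackCone (toModPFrobenius p C) (toModP p C)).pt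

/-- The first projection. -/
def ghostFst (C : CommRingCat.{u}) : ghostRing p C ⟶ C :=
  (CommRingCat.pullbackCone (toModPFrobenius p C) (toModP p C)).fst

/-- The second projection. -/
def ghostSnd (C : CommRingCat.{u}) : ghostRing p C ⟶ C :=
  (CommRingCat.pullbackCone (toModPFrobenius p C) (toModP p C)).snd

theorem isPullback_ghostRing (C : CommRingCat.{u}) :
    IsPullback (ghostFst p C) (ghostSnd p C) (toModPFrobenius p C) (toModP p C) :=
  ⟨⟨(CommRingCat.pullbackCone (toModPFrobenius p C) (toModP p C)).condition⟩,
    ⟨CommRingCat.pullbackConeIsLimit (toModPFrobenius p C) (toModP p C)⟩⟩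

/-- The map `W_1(C) → C ×_{C/p} C` with components `(x_0, x_1) ↦ x_0` and
`(x_0, x_1) ↦ x_0 ^ p + p x_1`. -/
def toGhostRing (C : CommRingCat.{u}) : (wittFunctor p 1).obj C ⟶ ghostRing p C :=
  (isPullback_ghostRing p C).lift (projHom p 1 C) (ghostHom p C) (by
    ext w
    refine ((toModP_eq_iff p C _ _).2 ⟨Witt.coeff w 1, ?_⟩).symm
    have h := ghostHom_apply p C w
    change ghostHom p C w - (Witt.coeff w 0) ^ p = _
    exact sub_eq_of_eq_add' h)

theorem toGhostRing_fst (C : CommRingCat.{u}) :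
    toGhostRing p C ≫ ghostFst p C = projHom p 1 C :=
  (isPullback_ghostRing p C).lift_fst _ _ _

theorem toGhostRing_snd (C : CommRingCat.{u}) :
    toGhostRing p C ≫ ghostSnd p C = ghostHom p C :=
  (isPullback_ghostRing p C).lift_snd _ _ _

theorem toGhostRing_surjective (C : CommRingCat.{u}) :
    Function.Surjective (toGhostRing p C) := by
  intro z
  have hz : toModP p C (ghostSnd p C z) = toModP p C (ghostFst p C z ^ p) := by
    rw [map_pow]
    exact (congrArg (fun f => f z) (congrArg CommRingCat.Hom.hom
      (isPullback_ghostRing p C).w)).symm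
  obtain ⟨c, hc⟩ := (toModP_eq_iff p C _ _).1 hz
  -- If `b = a^p + p c`, then `(a, c)` is a preimage of `(a, b)`.
  let w : Witt p 1 C := ⟨![ghostFst p C z, c]⟩
  refine ⟨w, ?_⟩
  have h1 : ghostFst p C (toGhostRing p C w) = ghostFst p C z :=
    congrArg (fun f => f.hom w) (toGhostRing_fst p C)
  have h2 : ghostSnd p C (toGhostRing p C w) = ghostSnd p C z := by
    refine (congrArg (fun f => f.hom w) (toGhostRing_snd p C)).trans
      ((ghostHom_apply p C w).trans ?_)
    change ghostFst p C z ^ p + (p : C) * c = _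
    rw [← hc]
    ring
  exact Subtype.ext (Prod.ext h1 h2)

variable {p}

/-- The kernel of the surjection `toGhostRing` consists of vectors `(0, x_1)` with `p x_1 = 0`, and
`t` kills such `x_1`. This is the point where torsion-freeness acts as a substitute for injectivity
of the ghost map. -/
theorem exists_ghostRing_to_witt {R S : CommRingCat.{u}} (t : R ⟶ S)
    (ht : ∀ r : R, (p : R) * r = 0 → t r = 0) :
    ∃ g : ghostRing p R ⟶ (wittFunctor p 1).obj S,
      toGhostRing p R ≫ g = (wittFunctor p 1).map t := by
  have hker : RingHom.ker (toGhostRing p R).hom ≤ RingHom.ker ((wittFunctor p 1).map t).hom := by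
    intro w hw
    have hw : toGhostRing p R w = 0 := hw
    have h0 : Witt.coeff w 0 = 0 := by
      have := congrArg (fun f => f.hom w) (toGhostRing_fst p R)
      change ghostFst p R (toGhostRing p R w) = Witt.coeff w 0 at this
      rw [← this, hw, map_zero]
    have h1 : (p : R) * Witt.coeff w 1 = 0 := by
      have := congrArg (fun f => f.hom w) (toGhostRing_snd p R)
      replace this := this.symm.trans ((congrArg (ghostSnd p R) hw).trans (map_zero _))
      have h := (ghostHom_apply p R w).symm.trans this
      rwa [h0, zero_pow hp.out.ne_zero, zero_add] at h
    refine Witt.ext (funext fun k => ?_)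
    change t (Witt.coeff w k) = 0
    fin_cases k
    · exact (congrArg t h0).trans (map_zero _)
    · exact ht _ h1
  refine ⟨CommRingCat.ofHom ((toGhostRing p R).hom.liftOfSurjective
    (toGhostRing_surjective p R) ⟨_, hker⟩), ?_⟩
  apply CommRingCat.hom_ext
  exact RingHom.liftOfSurjective_comp _ _ _

theorem ghostRing_hom_ext {R S : CommRingCat.{u}} {f g : ghostRing p R ⟶ S}
    (h : toGhostRing p R ≫ f = toGhostRing p R ≫ g) : f = g := by
  ext z
  obtain ⟨w, rfl⟩ := toGhostRing_surjective p R z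
  exact congrArg (fun f => f.hom w) h

end Ghost

/-! ### From a Frobenius lift to a natural section over `W_1`. -/

section FirstOrderLift

variable {p : ℕ} [hp : Fact p.Prime]

/-- A natural family of lifts of the points of `X` over `C` to points over `W_1(C)`. -/
structure FirstOrderLift (p : ℕ) [Fact p.Prime] (X : AffPresheaf.{u}) where
  /-- The lift of a point. -/
  lift : ∀ {C : CommRingCat.{u}}, X.obj C → X.obj ((wittFunctor p 1).obj C)
  map_lift : ∀ {C D : CommRingCat.{u}} (g : C ⟶ D) (x : X.obj C),
    X.map ((wittFunctor p 1).map g) (lift x) = lift (X.map g x)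
  proj_lift : ∀ {C : CommRingCat.{u}} (x : X.obj C), X.map (projHom p 1 C) (lift x) = x

theorem map_map {X : AffPresheaf.{u}} {A B C : CommRingCat.{u}} (f : A ⟶ B) (g : B ⟶ C)
    (x : X.obj A) : X.map g (X.map f x) = X.map (f ≫ g) x :=
  (Functor.map_comp_apply X f g x).symm

section Frobenius

variable {X : AffPresheaf.{u}} [PreservesFiniteLimits X]

/-- The two ghost components determine the image over the ring of pairs, which is a fibre product
preserved by `X`; and `W_1(t)` factors through that ring. -/
theorem map_witt_one_ext {R S : CommRingCat.{u}} (t : R ⟶ S)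
    (ht : ∀ r : R, (p : R) * r = 0 → t r = 0) {y y' : X.obj ((wittFunctor p 1).obj R)}
    (h : X.map (projHom p 1 R) y = X.map (projHom p 1 R) y')
    (h' : X.map (ghostHom p R) y = X.map (ghostHom p R) y') :
    X.map ((wittFunctor p 1).map t) y = X.map ((wittFunctor p 1).map t) y' := by
  obtain ⟨g, hg⟩ := exists_ghostRing_to_witt t ht
  have : X.map (toGhostRing p R) y = X.map (toGhostRing p R) y' := by
    refine pullback_ext X (isPullback_ghostRing p R) ?_ ?_
    · rwa [map_map, map_map, toGhostRing_fst]
    · rwa [map_map, map_map, toGhostRing_snd]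
  rw [← hg, ← map_map, ← map_map, this]

variable {φ : X ⟶ X}

theorem exists_witt_one (hX : HasTorsionKillingLifts p X) (hφ : IsFrobeniusLift p φ)
    {C : CommRingCat.{u}} (x : X.obj C) : ∃ y : X.obj ((wittFunctor p 1).obj C),
      X.map (projHom p 1 C) y = x ∧ X.map (ghostHom p C) y = φ.app C x := by
  obtain ⟨D, d, h, hh, rfl⟩ := hX C x
  obtain ⟨g, hg⟩ := exists_ghostRing_to_witt h hh
  -- By naturality `φ(d)` reduces to `φ(d mod p)`, which is the Frobenius applied to `d mod p` as `p
  -- = 0` in `D/p`.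
  have hd : X.map (toModPFrobenius p D) d = X.map (toModP p D) (φ.app D d) := by
    rw [toModPFrobenius, ← map_map, ← NatTrans.naturality_apply,
      hφ (modP p D) (frobeniusHom p _ (natCast_modP p D)) (natCast_modP p D) fun _ => rfl]
  obtain ⟨z, hz, hz'⟩ := exists_map_pullback X (isPullback_ghostRing p D) d (φ.app D d) hd
  refine ⟨X.map g z, ?_, ?_⟩
  · have : g ≫ projHom p 1 C = ghostFst p D ≫ h := ghostRing_hom_ext (by
      rw [reassoc_of% hg, projHom_naturality, ← toGhostRing_fst, Category.assoc])
    rw [map_map, this, ← map_map, hz]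
  · have : g ≫ ghostHom p C = ghostSnd p D ≫ h := ghostRing_hom_ext (by
      rw [reassoc_of% hg, ghostHom_naturality, ← toGhostRing_snd, Category.assoc])
    rw [map_map, this, ← map_map, hz', ← NatTrans.naturality_apply]

/-- The point `y` over `W_1(C)` is the lift of `x` determined by the Frobenius lift `φ`. -/
def IsLiftOf (p : ℕ) [Fact p.Prime] {X : AffPresheaf.{u}} (φ : X ⟶ X) {C : CommRingCat.{u}}
    (x : X.obj C) (y : X.obj ((wittFunctor p 1).obj C)) : Prop :=
  ∃ (D : CommRingCat.{u}) (d : X.obj D) (h : D ⟶ C) (z : X.obj ((wittFunctor p 1).obj D)),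
    (∀ r : D, (p : D) * r = 0 → h r = 0) ∧ X.map h d = x ∧
    X.map (projHom p 1 D) z = d ∧ X.map (ghostHom p D) z = φ.app D d ∧
    X.map ((wittFunctor p 1).map h) z = y

/-- When `C` has `p`-torsion, the ghost components over `C` need not determine `y`, so the
comparison takes place upstairs: `d` and `d'` glue to a point `e` over `D ×_C D'`, and any
ghost-compatible lift `v` of `e` induces both `y` and `y'`. -/
theorem IsLiftOf.unique (hX : HasTorsionKillingLifts p X) (hφ : IsFrobeniusLift p φ)
    {C : CommRingCat.{u}} {x : X.obj C} {y y' : X.obj ((wittFunctor p 1).obj C)}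
    (hy : IsLiftOf p φ x y) (hy' : IsLiftOf p φ x y') : y = y' := by
  obtain ⟨D, d, h, z, hh, hd, hz, hz', rfl⟩ := hy
  obtain ⟨D', d', k, w, hk, hd', hw, hw', rfl⟩ := hy'
  have H : IsPullback (pullback.fst h k) (pullback.snd h k) h k := IsPullback.of_hasPullback h k
  obtain ⟨e, rfl, rfl⟩ := exists_map_pullback X H d d' (hd.trans hd'.symm)
  obtain ⟨v, hv, hv'⟩ := exists_witt_one hX hφ e
  have h1 : X.map ((wittFunctor p 1).map h) z =
      X.map ((wittFunctor p 1).map h) (X.map ((wittFunctor p 1).map (pullback.fst h k)) v) := by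
    refine map_witt_one_ext h hh ?_ ?_
    · rw [hz, map_map, projHom_naturality, ← map_map, hv]
    · rw [hz', map_map, ghostHom_naturality, ← map_map, hv', NatTrans.naturality_apply]
  have h2 : X.map ((wittFunctor p 1).map k) w =
      X.map ((wittFunctor p 1).map k) (X.map ((wittFunctor p 1).map (pullback.snd h k)) v) := by
    refine map_witt_one_ext k hk ?_ ?_
    · rw [hw, map_map, projHom_naturality, ← map_map, hv]
    · rw [hw', map_map, ghostHom_naturality, ← map_map, hv', NatTrans.naturality_apply]
  -- The two composites `D ×_C D' → C` coincide, so both sides are the image of `v`.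
  rw [h1, h2, map_map, map_map, ← Functor.map_comp, ← Functor.map_comp, H.w]

theorem exists_isLiftOf (hX : HasTorsionKillingLifts p X) (hφ : IsFrobeniusLift p φ)
    {C : CommRingCat.{u}} (x : X.obj C) : ∃ y, IsLiftOf p φ x y := by
  obtain ⟨D, d, h, hh, hd⟩ := hX C x
  obtain ⟨z, hz, hz'⟩ := exists_witt_one hX hφ d
  exact ⟨_, D, d, h, z, hh, hd, hz, hz', rfl⟩

theorem IsLiftOf.map {C C' : CommRingCat.{u}} {x : X.obj C}
    {y : X.obj ((wittFunctor p 1).obj C)} (hy : IsLiftOf p φ x y) (g : C ⟶ C') :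
    IsLiftOf p φ (X.map g x) (X.map ((wittFunctor p 1).map g) y) := by
  obtain ⟨D, d, h, z, hh, rfl, hz, hz', rfl⟩ := hy
  refine ⟨D, d, h ≫ g, z, fun r hr => ?_, (map_map _ _ _).symm, hz, hz', ?_⟩
  · change g (h r) = 0
    rw [hh r hr, map_zero]
  · rw [map_map, Functor.map_comp]

theorem IsLiftOf.proj {C : CommRingCat.{u}} {x : X.obj C}
    {y : X.obj ((wittFunctor p 1).obj C)} (hy : IsLiftOf p φ x y) :
    X.map (projHom p 1 C) y = x := by
  obtain ⟨D, d, h, z, hh, rfl, hz, hz', rfl⟩ := hy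
  rw [map_map, projHom_naturality, ← map_map, hz]

theorem IsLiftOf.ghost {C : CommRingCat.{u}} {x : X.obj C}
    {y : X.obj ((wittFunctor p 1).obj C)} (hy : IsLiftOf p φ x y) :
    X.map (ghostHom p C) y = φ.app C x := by
  obtain ⟨D, d, h, z, hh, rfl, hz, hz', rfl⟩ := hy
  rw [map_map, ghostHom_naturality, ← map_map, hz', NatTrans.naturality_apply]

/-- The lift of points to `W_1` determined by a lift of the Frobenius. -/
def firstOrderLiftOfFrobenius (hX : HasTorsionKillingLifts p X) (hφ : IsFrobeniusLift p φ) :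
    FirstOrderLift p X where
  lift x := (exists_isLiftOf hX hφ x).choose
  map_lift g x := ((exists_isLiftOf hX hφ x).choose_spec.map g).unique hX hφ
    (exists_isLiftOf hX hφ _).choose_spec
  proj_lift x := (exists_isLiftOf hX hφ x).choose_spec.proj

theorem ghost_firstOrderLiftOfFrobenius (hX : HasTorsionKillingLifts p X)
    (hφ : IsFrobeniusLift p φ) {C : CommRingCat.{u}} (x : X.obj C) :
    X.map (ghostHom p C) ((firstOrderLiftOfFrobenius hX hφ).lift x) = φ.app C x :=
  (exists_isLiftOf hX hφ x).choose_spec.ghost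

end Frobenius

end FirstOrderLift

/-! ### Iterating a section over `W_1` to a co-action. -/

section Coaction

variable {p : ℕ} [hp : Fact p.Prime]

theorem projHom_zero_injective (C : CommRingCat.{u}) : Function.Injective (projHom p 0 C) := by
  intro a b h
  refine Witt.ext (funext fun k => ?_)
  rw [Fin.fin_one_eq_zero k]
  exact h

theorem comulHom_one_injective (n : ℕ) (C : CommRingCat.{u}) :
    Function.Injective (comulHom p n 1 C) := by
  intro a b h
  have hc : ∀ (i : Fin 2) (j : Fin (n + 1)),
      Witt.coeff a ⟨i + j, by omega⟩ = Witt.coeff b ⟨i + j, by omega⟩ := fun i j =>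
    congrArg (fun w : Witt p 1 (Witt p n C) => (w.coeff i).coeff j) h
  refine Witt.ext (funext fun k => ?_)
  obtain ⟨k, hk⟩ := k
  -- Entries of index at most `n` are read off the zeroth component; the last one is the final entry
  -- of the first component.
  obtain hk' | rfl : k < n + 1 ∨ k = n + 1 := by omega
  · have := hc 0 ⟨k, hk'⟩
    simpa using this
  · have := hc 1 ⟨n, by omega⟩
    simpa [add_comm] using this

theorem comulHom_one_proj (n : ℕ) (C : CommRingCat.{u}) :
    comulHom p n 1 C ≫ projHom p 1 _ = truncHom p (Nat.le_succ n) C := by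
  apply CommRingCat.hom_ext
  apply RingHom.ext
  intro w
  refine Witt.ext (funext fun j => ?_)
  change w.coeff ⟨0 + (j : ℕ), _⟩ = w.coeff ⟨j, _⟩
  simp

theorem comulHom_zero_one_bijective (C : CommRingCat.{u}) :
    Function.Bijective (comulHom p 0 1 C) := by
  refine ⟨comulHom_one_injective 0 C, fun a => ⟨⟨fun i => (Witt.coeff a i).coeff 0⟩, ?_⟩⟩
  refine Witt.ext (funext fun i => Witt.ext (funext fun j => ?_))
  rw [Fin.fin_one_eq_zero j]
  rfl

/-- For `a = (u, v)` the equation says `v_j = u_(j+1)` for `j ≤ n`, which is the condition for `u`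
and `v` to overlap as two windows of a single vector. -/
theorem comulHom_one_equalizer (n : ℕ) (C : CommRingCat.{u})
    (a : (wittFunctor p 1).obj ((wittFunctor p (n + 1)).obj C)) :
    (wittFunctor p 1).map (truncHom p (Nat.le_succ n) C) a =
      (projHom p 1 _ ≫ comulHom p n 1 C) a ↔ ∃ z, comulHom p (n + 1) 1 C z = a := by
  constructor
  · intro h
    have hc : ∀ j : Fin (n + 1),
        (Witt.coeff a 1).coeff ⟨j, by omega⟩ = (Witt.coeff a 0).coeff ⟨1 + j, by omega⟩ := fun j =>
      congrArg (fun w : Witt p 1 (Witt p n C) => (w.coeff 1).coeff j) h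
    -- The glued vector is `(u_0, v_0, …, v_(n+1))`.
    refine ⟨⟨Fin.cons ((Witt.coeff a 0).coeff 0) (Witt.coeff a 1).coeff⟩, ?_⟩
    refine Witt.ext (funext fun i => Witt.ext (funext fun j => ?_))
    obtain ⟨j, hj⟩ := j
    change (Fin.cons ((Witt.coeff a 0).coeff 0) (Witt.coeff a 1).coeff : Fin (n + 1 + 1 + 1) → C)
      ⟨i + j, _⟩ = _
    fin_cases i
    · cases j with
      | zero => rfl
      | succ j =>
        have := hc ⟨j, by omega⟩
        simp only [add_comm 1] at this
        refine Eq.trans ?_ this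
        simp only [Nat.zero_add]
        rfl
    · simp only [add_comm _ j]
      rfl
  · rintro ⟨z, rfl⟩
    refine Witt.ext (funext fun i => Witt.ext (funext fun j => ?_))
    change Witt.coeff z ⟨i + j, _⟩ = Witt.coeff z ⟨0 + (i + j : ℕ), _⟩
    simp

/-- A truncated form of coassociativity: both sides send `w` to the array `w_(i+j+l)`. It is what
makes horizontality stable under `comulHom`. -/
theorem comulHom_trunc_comulHom {m n k : ℕ} (h : k + 1 ≤ n) (C : CommRingCat.{u}) :
    comulHom p m n C ≫ truncHom p h _ ≫ comulHom p k 1 _ =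
      truncHom p (Nat.add_le_add_left h m) C ≫ comulHom p (m + k) 1 C ≫
        (wittFunctor p 1).map (comulHom p m k C) := by
  apply CommRingCat.hom_ext
  apply RingHom.ext
  intro w
  refine Witt.ext (funext fun i => Witt.ext (funext fun j => Witt.ext (funext fun l => ?_)))
  change w.coeff ⟨(i + j : ℕ) + l, _⟩ = w.coeff ⟨i + (j + l : ℕ), _⟩
  simp [add_assoc]

theorem comulHom_proj (m n : ℕ) (C : CommRingCat.{u}) :
    comulHom p m n C ≫ projHom p n _ = truncHom p (Nat.le_add_right m n) C := by
  apply CommRingCat.hom_ext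
  apply RingHom.ext
  intro w
  refine Witt.ext (funext fun j => ?_)
  change w.coeff ⟨0 + (j : ℕ), _⟩ = w.coeff ⟨j, _⟩
  simp

namespace FirstOrderLift

variable {X : AffPresheaf.{u}} (s : FirstOrderLift p X)

/-- A point over `W_n(C)` is horizontal if it is obtained from its projection over `C` by
iterating the lift `s`. -/
def IsHorizontal {n : ℕ} {C : CommRingCat.{u}} (y : X.obj ((wittFunctor p n).obj C)) : Prop :=
  ∀ (k : ℕ) (h : k + 1 ≤ n), X.map (comulHom p k 1 C) (X.map (truncHom p h C) y) =
    s.lift (X.map (truncHom p (Nat.le_of_succ_le h) C) y)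

variable {s}

theorem IsHorizontal.map {n : ℕ} {C D : CommRingCat.{u}}
    {y : X.obj ((wittFunctor p n).obj C)} (hy : s.IsHorizontal y) (g : C ⟶ D) :
    s.IsHorizontal (X.map ((wittFunctor p n).map g) y) := by
  intro k h
  have := congrArg (X.map ((wittFunctor p 1).map ((wittFunctor p k).map g))) (hy k h)
  rw [s.map_lift] at this
  simp only [map_map] at this ⊢
  exact this

theorem IsHorizontal.trunc {m n : ℕ} (hmn : m ≤ n) {C : CommRingCat.{u}}
    {y : X.obj ((wittFunctor p n).obj C)} (hy : s.IsHorizontal y) :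
    s.IsHorizontal (X.map (truncHom p hmn C) y) := by
  intro k h
  have := hy k (h.trans hmn)
  simp only [map_map] at this ⊢
  exact this

theorem IsHorizontal.comul {m n : ℕ} {C : CommRingCat.{u}}
    {y : X.obj ((wittFunctor p (m + n)).obj C)} (hy : s.IsHorizontal y) :
    s.IsHorizontal (X.map (comulHom p m n C) y) := by
  intro k h
  have := congrArg (X.map ((wittFunctor p 1).map (comulHom p m k C)))
    (hy (m + k) (Nat.add_le_add_left h m))
  rw [s.map_lift] at this
  simp only [map_map] at this ⊢
  rw [Category.assoc, comulHom_trunc_comulHom, ← Category.assoc]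
  exact this

variable [PreservesFiniteLimits X]

/-- Induction on `n`: the truncations agree, hence so do their lifts, and these are the images of
the points under `comulHom p n 1 C`, which is injective on rings and therefore on points of `X`. -/
theorem IsHorizontal.ext {n : ℕ} {C : CommRingCat.{u}}
    {y y' : X.obj ((wittFunctor p n).obj C)} (hy : s.IsHorizontal y) (hy' : s.IsHorizontal y')
    (h : X.map (projHom p n C) y = X.map (projHom p n C) y') : y = y' := by
  induction n with
  | zero => exact map_injective_of_injective X _ (projHom_zero_injective C) h
  | succ n ih =>
    have ht := ih (hy.trunc n.le_succ) (hy'.trunc n.le_succ) (by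
      simp only [map_map]
      exact h)
    refine map_injective_of_injective X _ (comulHom_one_injective n C) ?_
    have h1 := (hy n le_rfl).trans ((congrArg s.lift ht).trans (hy' n le_rfl).symm)
    simp only [map_map] at h1
    exact h1

theorem exists_comulHom_one {n : ℕ} {C : CommRingCat.{u}}
    {y : X.obj ((wittFunctor p n).obj C)} (hy : s.IsHorizontal y) :
    ∃ z : X.obj ((wittFunctor p (n + 1)).obj C), X.map (comulHom p n 1 C) z = s.lift y := by
  cases n with
  | zero =>
    have : IsIso (comulHom p 0 1 C) :=
      (ConcreteCategory.isIso_iff_bijective _).2 (comulHom_zero_one_bijective C)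
    exact ⟨X.map (inv (comulHom p 0 1 C)) (s.lift y), by simp⟩
  | succ n =>
    refine exists_map_equalizer X _ _ _ (comulHom_one_injective (n + 1) C)
      (comulHom_one_equalizer n C) _ ?_
    -- Both maps of the equalizer send `s.lift y` to the lift of the truncation of `y`: one by
    -- naturality of the lift, the other by horizontality of `y`.
    rw [s.map_lift, ← map_map, s.proj_lift, ← hy n le_rfl, map_map]
    rfl

theorem exists_isHorizontal (s : FirstOrderLift p X) (n : ℕ) {C : CommRingCat.{u}}
    (x : X.obj C) : ∃ y : X.obj ((wittFunctor p n).obj C),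
      s.IsHorizontal y ∧ X.map (projHom p n C) y = x := by
  induction n with
  | zero =>
    -- Over `W_0(C)` horizontality is vacuous; truncating the lift yields a point with the right
    -- projection.
    refine ⟨X.map (truncHom p (Nat.zero_le 1) C) (s.lift x), fun k h => by omega, ?_⟩
    rw [map_map]
    exact s.proj_lift x
  | succ n ih =>
    obtain ⟨y, hy, hyx⟩ := ih
    obtain ⟨z, hz⟩ := exists_comulHom_one hy
    have hzy : X.map (truncHom p n.le_succ C) z = y := by
      rw [← comulHom_one_proj, ← map_map, hz, s.proj_lift]
    refine ⟨z, fun k h => ?_, ?_⟩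
    · obtain rfl | hk : k = n ∨ k + 1 ≤ n := by omega
      · rw [hzy, ← hz, map_map]
        rfl
      · have := hy k hk
        rw [← hzy] at this
        simp only [map_map] at this ⊢
        exact this
    · rw [← hyx, ← hzy, map_map]
      rfl

variable (s)

/-- The horizontal lift of a point over `C` to a point over `W_n(C)`. -/
def horizontalLift (n : ℕ) {C : CommRingCat.{u}} (x : X.obj C) :
    X.obj ((wittFunctor p n).obj C) :=
  (s.exists_isHorizontal n x).choose

theorem isHorizontal_horizontalLift (n : ℕ) {C : CommRingCat.{u}} (x : X.obj C) :
    s.IsHorizontal (s.horizontalLift n x) :=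
  (s.exists_isHorizontal n x).choose_spec.1

theorem proj_horizontalLift (n : ℕ) {C : CommRingCat.{u}} (x : X.obj C) :
    X.map (projHom p n C) (s.horizontalLift n x) = x :=
  (s.exists_isHorizontal n x).choose_spec.2

variable {s} in
theorem IsHorizontal.eq_horizontalLift {n : ℕ} {C : CommRingCat.{u}}
    {y : X.obj ((wittFunctor p n).obj C)} (hy : s.IsHorizontal y) {x : X.obj C}
    (h : X.map (projHom p n C) y = x) : y = s.horizontalLift n x :=
  hy.ext (s.isHorizontal_horizontalLift n x) (h.trans (s.proj_horizontalLift n x).symm)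

theorem horizontalLift_one {C : CommRingCat.{u}} (x : X.obj C) :
    s.horizontalLift 1 x = s.lift x := by
  have h := s.isHorizontal_horizontalLift 1 x 0 le_rfl
  have h1 := congrArg (X.map ((wittFunctor p 1).map (projHom p 0 C))) h
  rw [s.map_lift] at h1
  simp only [map_map] at h1
  refine Eq.trans ?_ (h1.trans (congrArg s.lift (s.proj_horizontalLift 1 x)))
  -- The composite `W_1(C) → W_1(W_0(C)) → W_1(C)` is the identity by definition.
  exact (Functor.map_id_apply X _ _).symm

theorem trunc_horizontalLift {m n : ℕ} (h : n ≤ m) {C : CommRingCat.{u}} (x : X.obj C) :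
    X.map (truncHom p h C) (s.horizontalLift m x) = s.horizontalLift n x := by
  refine ((s.isHorizontal_horizontalLift m x).trunc h).eq_horizontalLift ?_
  rw [map_map]
  exact s.proj_horizontalLift m x

theorem map_horizontalLift (n : ℕ) {C D : CommRingCat.{u}} (g : C ⟶ D) (x : X.obj C) :
    X.map ((wittFunctor p n).map g) (s.horizontalLift n x) = s.horizontalLift n (X.map g x) := by
  refine ((s.isHorizontal_horizontalLift n x).map g).eq_horizontalLift ?_
  rw [map_map, projHom_naturality, ← map_map, s.proj_horizontalLift]

/-- Coassociativity of the co-action: both sides are horizontal for the ring `W_m(C)`, with the same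
projection. -/
theorem comul_horizontalLift (m n : ℕ) {C : CommRingCat.{u}} (x : X.obj C) :
    X.map (comulHom p m n C) (s.horizontalLift (m + n) x) =
      s.horizontalLift n (s.horizontalLift m x) := by
  refine (s.isHorizontal_horizontalLift (m + n) x).comul.eq_horizontalLift ?_
  rw [map_map, comulHom_proj, trunc_horizontalLift]

/-- The co-action `X → J(X)` determined by a natural lift of points to `W_1`. -/
def coaction : X ⟶ jetObj p X where
  app C := ↾fun x => (⟨fun n => s.horizontalLift n x, fun _ _ h =>
    s.trunc_horizontalLift h x⟩ : JetPoint p X C)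
  naturality C D g := by
    ext x
    apply JetPoint.ext
    funext n
    exact (s.map_horizontalLift n g x).symm

/-- The coalgebra of the comonad `J` determined by a natural lift of points to `W_1`. -/
def coalgebra : (jet.{u} p).Coalgebra where
  A := X
  a := s.coaction
  counit := by
    ext C x
    exact s.proj_horizontalLift 0 x
  coassoc := by
    ext C x
    apply JetPoint.ext
    funext m
    apply JetPoint.ext
    funext n
    exact s.comul_horizontalLift m n x

end FirstOrderLift

end Coaction

/-! ### Coalgebras and their Frobenius lifts. -/

section Coalgebra

variable {p : ℕ} [hp : Fact p.Prime] (A : (jet.{u} p).Coalgebra)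

/-- The component over `W_n(C)` of the co-action of a `J`-coalgebra at a point over `C`. -/
def coactionVal (n : ℕ) {C : CommRingCat.{u}} (x : A.A.obj C) :
    A.A.obj ((wittFunctor p n).obj C) :=
  (A.a.app C x : JetPoint p A.A C).val n

theorem trunc_coactionVal {m n : ℕ} (h : n ≤ m) {C : CommRingCat.{u}} (x : A.A.obj C) :
    A.A.map (truncHom p h C) (coactionVal A m x) = coactionVal A n x :=
  (A.a.app C x : JetPoint p A.A C).compat m n h

theorem proj_coactionVal (n : ℕ) {C : CommRingCat.{u}} (x : A.A.obj C) :
    A.A.map (projHom p n C) (coactionVal A n x) = x := by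
  have h : A.A.map (projHom p 0 C) (coactionVal A 0 x) = x :=
    congrArg (fun f : A.A ⟶ A.A => f.app C x) A.counit
  rw [← trunc_coactionVal A (Nat.zero_le n), map_map] at h
  exact h

theorem map_coactionVal (n : ℕ) {C D : CommRingCat.{u}} (g : C ⟶ D) (x : A.A.obj C) :
    A.A.map ((wittFunctor p n).map g) (coactionVal A n x) = coactionVal A n (A.A.map g x) := by
  have h : (A.a.app D (A.A.map g x) : JetPoint p A.A D) = (jetObj p A.A).map g (A.a.app C x) :=
    NatTrans.naturality_apply (F := A.A) (G := jetObj p A.A) A.a g x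
  exact (congrArg (fun a : JetPoint p A.A D => a.val n) h).symm

theorem comul_coactionVal (m n : ℕ) {C : CommRingCat.{u}} (x : A.A.obj C) :
    A.A.map (comulHom p m n C) (coactionVal A (m + n) x) = coactionVal A n (coactionVal A m x) :=
  congrArg (fun f : A.A ⟶ jetObj p (jetObj p A.A) =>
    ((f.app C x : JetPoint p (jetObj p A.A) C).val m :
      JetPoint p A.A ((wittFunctor p m).obj C)).val n) A.coassoc

/-- The lift of points to `W_1` underlying a `J`-coalgebra. -/
def firstOrderLiftOfCoalgebra : FirstOrderLift p A.A where
  lift x := coactionVal A 1 x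
  map_lift g x := map_coactionVal A 1 g x
  proj_lift x := proj_coactionVal A 1 x

/-- Coassociativity with outer length one: every co-action is the iteration of its own
`W_1`-component. -/
theorem isHorizontal_coactionVal (n : ℕ) {C : CommRingCat.{u}} (x : A.A.obj C) :
    (firstOrderLiftOfCoalgebra A).IsHorizontal (coactionVal A n x) := by
  intro k h
  rw [trunc_coactionVal, trunc_coactionVal]
  exact comul_coactionVal A k 1 x

theorem ghost_coactionVal {C : CommRingCat.{u}} (x : A.A.obj C) :
    A.A.map (ghostHom p C) (coactionVal A 1 x) = (frobeniusOf A.a).app C x := by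
  rw [ghostHom, ← map_map]
  rfl

theorem frobeniusOf_coalgebra {X : AffPresheaf.{u}} [PreservesFiniteLimits X]
    (s : FirstOrderLift p X) {C : CommRingCat.{u}} (x : X.obj C) :
    (frobeniusOf s.coaction).app C x = X.map (ghostHom p C) (s.lift x) := by
  rw [← s.horizontalLift_one]
  exact (ghost_coactionVal s.coalgebra x).symm

/-- Torsion-killing lifts in the source reduce the `W_1`-components to ghost components, where the
hypothesis applies; left exactness of the target then gives uniqueness of horizontal points over all
`W_n`. -/
theorem comm_of_frobeniusOf_comm {A B : (jet.{u} p).Coalgebra} (hA : HasTorsionKillingLifts p A.A)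
    [PreservesFiniteLimits B.A] (f : A.A ⟶ B.A)
    (hf : frobeniusOf A.a ≫ f = f ≫ frobeniusOf B.a) :
    A.a ≫ jetMap p f = f ≫ B.a := by
  have h1 : ∀ {C : CommRingCat.{u}} (x : A.A.obj C),
      f.app _ (coactionVal A 1 x) = coactionVal B 1 (f.app C x) := by
    intro C x
    obtain ⟨D, d, h, hh, rfl⟩ := hA C x
    rw [← map_coactionVal, NatTrans.naturality_apply, NatTrans.naturality_apply,
      ← map_coactionVal]
    -- Both points are now images under `W_1(h)` of points over `W_1(D)`, so equal ghost components
    -- over `D` suffice.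
    refine map_witt_one_ext h hh ?_ ?_
    · rw [← NatTrans.naturality_apply, proj_coactionVal, proj_coactionVal]
    · rw [← NatTrans.naturality_apply, ghost_coactionVal, ghost_coactionVal]
      exact congrArg (fun g : A.A ⟶ B.A => g.app D d) hf
  ext C x
  apply JetPoint.ext
  funext n
  change f.app _ (coactionVal A n x) = coactionVal B n (f.app C x)
  refine FirstOrderLift.IsHorizontal.ext (s := firstOrderLiftOfCoalgebra B) ?_
    (isHorizontal_coactionVal B n _) ?_
  -- The image under `f` of a horizontal point is horizontal, because `f` is natural and respects
  -- the `W_1`-lifts by `h1`.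
  · intro k h
    rw [← NatTrans.naturality_apply, ← NatTrans.naturality_apply, ← NatTrans.naturality_apply,
      isHorizontal_coactionVal A n x k h]
    exact h1 _
  · rw [← NatTrans.naturality_apply, proj_coactionVal, proj_coactionVal]

end Coalgebra

/-! ### The forgetful functor is faithful, full and essentially surjective. -/

section Equivalence

variable (p : ℕ) [hp : Fact p.Prime]

instance : (forgetPTorsionFreeIndAffine.{u} p).Faithful where
  map_injective {A B} f g h := by
    apply ObjectProperty.hom_ext
    apply ObjectProperty.hom_ext
    apply Comonad.Coalgebra.Hom.ext
    exact congrArg (fun k : (forgetPTorsionFreeIndAffine.{u} p).obj A ⟶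
      (forgetPTorsionFreeIndAffine.{u} p).obj B => FrobeniusSheaf.Hom.f k.hom) h

instance : (forgetPTorsionFreeIndAffine.{u} p).Full where
  map_surjective {A B} f :=
    have : PreservesFiniteLimits B.obj.obj.A :=
      preservesFiniteLimits_of_isPTorsionFreeIndAffine B.property
    ⟨ObjectProperty.homMk (ObjectProperty.homMk
      { f := FrobeniusSheaf.Hom.f f.hom
        h := comm_of_frobeniusOf_comm
          (B := B.obj.obj)
          (hasTorsionKillingLifts_of_isPTorsionFreeIndAffine A.property) _
          (FrobeniusSheaf.Hom.comm f.hom) }), rfl⟩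

instance : (forgetPTorsionFreeIndAffine.{u} p).EssSurj where
  mem_essImage Y := by
    have := preservesFiniteLimits_of_isPTorsionFreeIndAffine Y.property
    have hY := hasTorsionKillingLifts_of_isPTorsionFreeIndAffine Y.property
    let s := firstOrderLiftOfFrobenius hY Y.obj.isFrobeniusLift
    have hs : frobeniusOf s.coaction = Y.obj.φ := by
      ext C x
      exact (frobeniusOf_coalgebra s x).trans
        (ghost_firstOrderLiftOfFrobenius hY Y.obj.isFrobeniusLift x)
    let A : PTorsionFreeIndAffineDeltaSheaf.{u} p :=
      ⟨⟨s.coalgebra, Y.obj.isSheaf⟩, Y.property⟩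
    let F := (forgetPTorsionFreeIndAffine.{u} p).obj A
    -- The two Frobenius lifts on the same sheaf agree by `hs`, so the identity is a morphism in
    -- both directions.
    have hc : frobeniusOf s.coaction ≫ 𝟙 Y.obj.X = 𝟙 Y.obj.X ≫ Y.obj.φ := by
      rw [hs, Category.comp_id, Category.id_comp]
    have hc' : Y.obj.φ ≫ 𝟙 Y.obj.X = 𝟙 Y.obj.X ≫ frobeniusOf s.coaction := by
      rw [hs, Category.comp_id, Category.id_comp]
    let a : F.obj ⟶ Y.obj := FrobeniusSheaf.Hom.mk (X := F.obj) (Y := Y.obj) (𝟙 Y.obj.X) hc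
    let b : Y.obj ⟶ F.obj := FrobeniusSheaf.Hom.mk (X := Y.obj) (Y := F.obj) (𝟙 Y.obj.X) hc'
    exact ⟨A, ⟨⟨ObjectProperty.homMk a, ObjectProperty.homMk b,
      ObjectProperty.hom_ext _ (FrobeniusSheaf.Hom.ext (Category.id_comp _)),
      ObjectProperty.hom_ext _ (FrobeniusSheaf.Hom.ext (Category.id_comp _))⟩⟩⟩

end Equivalence

end

end DeltaSheaves

/-- The forgetful functor from `p`-torsion free ind-affine `δ`-sheaves to `p`-torsion free
ind-affine sheaves equipped with a lift of the Frobenius is an equivalence of categories. -/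
theorem proposition2p4p1 (p : ℕ) [Fact p.Prime] :
    (DeltaSheaves.forgetPTorsionFreeIndAffine.{u} p).IsEquivalence := { }
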